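/- Let $n\ge 1$, let $\Omega\subset\mathbb R^n$ be open, let $\mu$ be a finite nonnegative Radon measure on $\Omega$, and let $x_0\in\Omega$ and $r_0>0$ be such that $B(x_0,3r_0)\subset\Omega$. For $p\in(1,n]$ define the Wolff potential $$W^{\mu}_{1,p}(x,r)=\int_0^r\Big(\frac{\mu(B(x,t))}{t^{n-p}}\Big)^{\frac1{p-1}}\frac{dt}{t}\in[0,\infty].$$ For an open set $U\subset\mathbb R^n$ and compact $K\subset U$ let $\mathrm{cap}_p(K,U)=\inf\{\int_U|\nabla u|^p\,dx : u\in C_0^\infty(U),\ u\ge 1 \text{ on } K\}$, where $C_0^\infty(U)$ is the set of smooth functions with compact support in $U$. For arbitrary $E\subset U$ let $\mathrm{cap}_p(E,U)=\inf_{G}\sup_{K}\mathrm{cap}_p(K,U)$, the infimum being over open $G$ with $E\subset G\subset U$ and the supremum over compact $K\subset G$. Put $\omega_i=\{x: 2^{-i}\le|x-x_0|\le 2^{-i+1}\}$ and $\Omega_i=\{x: 2^{-i-1}<|x-x_0|<2^{-i+2}\}$. A set $E\subset\mathbb R^n$ is called $p$-thin for singular behavior at $x_0$ if $$\sum_{i=1}^\infty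 \frac{\mathrm{cap}_p(E\cap\omega_i,\Omega_i)}{\mathrm{cap}_p(\partial B(x_0,2^{-i}),B(x_0,2^{-i+1}))}<\infty\quad(1<p<n),\qquad \sum_{i=1}^\infty i^{\,n-1}\,\mathrm{cap}_n(E\cap\omega_i,\Omega_i)<\infty\quad(p=n\ge2).$$ (i) For every $p$ with $1<p<n$ there is a set $E\subset\Omega$ that is $p$-thin for singular behavior at $x_0$ such that $$\lim_{x\to x_0,\ x\ne x_0,\ x\notin E}|x-x_0|^{\frac{n-p}{p-1}}\,W^{\mu}_{1,p}(x,r_0)=\frac{p-1}{n-p}\,\mu(\{x_0\})^{\frac1{p-1}}.$$ (ii) If $n\ge2$, there is a set $E\subset\Omega$ that is $n$-thin for singular behavior at $x_0$ such that $$\lim_{x\to x_0,\ x\ne x_0,\ x\notin E}\frac{W^{\mu}_{1,n}(x,r_0)}{\log\frac1{|x-x_0|}}=\mu(\{x_0\})^{\frac1{n-1}}.$$ -/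

import Mathlib

open MeasureTheory Filter Set
open scoped ENNReal Topology

noncomputable section

namespace NonlinearPotential

/-- The `p`-capacity `inf { ∫_Ω |∇u|^p dx : u ∈ C₀^∞(Ω), u ≥ 1 on K }` of a compact set `K ⊆ Ω`.
Here `C₀^∞(Ω)` is the space of smooth functions with compact support contained in `Ω`. -/
def capCompact {n : ℕ} (p : ℝ) (K Ω : Set (EuclideanSpace ℝ (Fin n))) : ℝ≥0∞ :=
  ⨅ (u : EuclideanSpace ℝ (Fin n) → ℝ)
    (_ : ContDiff ℝ ((⊤ : ℕ∞) : WithTop ℕ∞) u ∧ HasCompactSupport u ∧ tsupport u ⊆ Ω ∧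
      ∀ x ∈ K, 1 ≤ u x),
    ∫⁻ x in Ω, ENNReal.ofReal (‖gradient u x‖ ^ p)

/-- The `p`-capacity of an arbitrary subset `E` of an open set `Ω`: the infimum over open
`G` with `E ⊆ G ⊆ Ω` of the supremum of the capacities of the compact subsets of `G`. -/
def cap {n : ℕ} (p : ℝ) (E Ω : Set (EuclideanSpace ℝ (Fin n))) : ℝ≥0∞ :=
  ⨅ (G : Set (EuclideanSpace ℝ (Fin n))) (_ : IsOpen G ∧ E ⊆ G ∧ G ⊆ Ω),
    ⨆ (K : Set (EuclideanSpace ℝ (Fin n))) (_ : IsCompact K ∧ K ⊆ G), capCompact p K Ω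

/-- The closed dyadic annulus `2^{-i} ≤ |x - x₀| ≤ 2^{-i+1}`. -/
def annulus {n : ℕ} (x₀ : EuclideanSpace ℝ (Fin n)) (i : ℕ) : Set (EuclideanSpace ℝ (Fin n)) :=
  {x | (2 : ℝ) ^ (-(i : ℤ)) ≤ ‖x - x₀‖ ∧ ‖x - x₀‖ ≤ (2 : ℝ) ^ (-(i : ℤ) + 1)}

/-- The open enlarged dyadic annulus `2^{-i-1} < |x - x₀| < 2^{-i+2}`. -/
def bigAnnulus {n : ℕ} (x₀ : EuclideanSpace ℝ (Fin n)) (i : ℕ) :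
    Set (EuclideanSpace ℝ (Fin n)) :=
  {x | (2 : ℝ) ^ (-(i : ℤ) - 1) < ‖x - x₀‖ ∧ ‖x - x₀‖ < (2 : ℝ) ^ (-(i : ℤ) + 2)}

/-- `E` is `p`-thin for singular behavior at `x₀`, for `1 < p < n`. The sum runs over
`i = 1, 2, 3, …`, written as `i + 1` with `i : ℕ`. -/
def IsPThin {n : ℕ} (p : ℝ) (E : Set (EuclideanSpace ℝ (Fin n)))
    (x₀ : EuclideanSpace ℝ (Fin n)) : Prop :=
  ∑' i : ℕ, cap p (E ∩ annulus x₀ (i + 1)) (bigAnnulus x₀ (i + 1)) /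
      cap p (Metric.sphere x₀ ((2 : ℝ) ^ (-((i + 1 : ℕ) : ℤ))))
        (Metric.ball x₀ ((2 : ℝ) ^ (-((i + 1 : ℕ) : ℤ) + 1))) < ⊤

/-- `E` is `n`-thin for singular behavior at `x₀` in dimension `n ≥ 2`. The sum runs over
`i = 1, 2, 3, …`, written as `i + 1` with `i : ℕ`. -/
def IsNThin {n : ℕ} (E : Set (EuclideanSpace ℝ (Fin n)))
    (x₀ : EuclideanSpace ℝ (Fin n)) : Prop :=
  ∑' i : ℕ, ((i + 1 : ℕ) : ℝ≥0∞) ^ (n - 1) *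
      cap (n : ℝ) (E ∩ annulus x₀ (i + 1)) (bigAnnulus x₀ (i + 1)) < ⊤

/-- The Wolff potential `∫_0^r (μ(B(x,t)) / t^{n-p})^{1/(p-1)} dt/t`, with values in `[0,∞]`. -/
def wolff {n : ℕ} (p : ℝ) (μ : Measure (EuclideanSpace ℝ (Fin n)))
    (x : EuclideanSpace ℝ (Fin n)) (r : ℝ) : ℝ≥0∞ :=
  ∫⁻ t in Ioo (0 : ℝ) r,
    (μ (Metric.ball x t) / ENNReal.ofReal (t ^ ((n : ℝ) - p))) ^ (1 / (p - 1)) /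
      ENNReal.ofReal t

end NonlinearPotential

end

/-!
Write `s = 1/(p-1)`, `α = (n-p)s` and `d = |x - x₀|`, and split the Wolff potential at `x` into the
radii `t > d`, `d/64 ≤ t ≤ d` and `t < d/64`. For `t > d` the ball `B(x, t)` contains `x₀`, and for
small `t` its mass is nearly `μ({x₀})`; this part produces the limit (`tendsto_wolffPart_outer`). In
the middle range the ball misses `x₀` and lies in a small punctured ball, whose mass tends to `0`
(`tendsto_wolffPart_middle`). Only the radii below `d/64` require an exceptional set. On the `i`-th
dyadic annulus they see only the restriction `μᵢ` of `μ` to a slightly larger annulus, and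
`∑ μᵢ(ℝⁿ) < ∞`.

The exceptional set is controlled by the weak-type estimate
`cap_p({W^ν > Λ}) ≤ C ν(ℝⁿ) Λ^{1-p}` (`exists_isOpen_capCompact_le`), which is proved here by
an explicit test function, with no theory of the `p`-Laplacian or of dual capacities. In the dyadic
form `∑ᵢ (ν(B(x, ρᵢ)) / ρᵢ^{n-p})^s` of the potential, `ν(B(x, ρ))^s` is replaced by a mollification
`smoothedMass`. The resulting smooth function `V` has compact support, dominates the dyadic
potential, and its gradient is bounded by `∑ᵢ (ν(B(x, 4ρᵢ)) / ρᵢ^{n-1})^s`. The test function is a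
smooth truncation of `V/Λ`, whose energy lives on `{V ≤ Λ}`, so the estimate reduces to the
localized Wolff inequality `exists_setLIntegral_rpow_sum_massRatio_le`. For that, `(∑ bᵢ)^p` is
bounded by `C ∑_{j ≤ k} √2^{k-j} b_j b_k^{p-1}` (`rpow_sum_le_sum_sum`). Since `b_k^{p-1}` is linear
in `ν`, Tonelli's theorem turns the integral into an integral over `ν` of dyadic Wolff sums at
points near `{V ≤ Λ}`, which are at most a multiple of `Λ`.

With `εᵢ → 0` and `∑ μᵢ(ℝⁿ)/εᵢ < ∞` (`threshold`), the estimate is applied to `μᵢ` at the level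
`(εᵢ / 2^{-i(n-p)})^s`, times `i + 1` when `p = n`. Together with the lower bound
`cap_p(∂B_r, B_{2r}) ≥ c r^{n-p}` (`exists_le_capCompact_sphere`) this gives thinness, while outside
the exceptional set the small radii contribute `O(εᵢ^s)` after normalization.
-/

noncomputable section
namespace NonlinearPotential

variable {n : ℕ}

/-! ### Discrete inequalities -/

lemma rpow_sum_le_sum_pow_mul_rpow {q : ℝ} (hq : 0 < q) :
    ∃ C : ℝ, 0 < C ∧ ∀ (N : ℕ) (b : ℕ → ℝ), (∀ i, 0 ≤ b i) →
      (∑ i ∈ Finset.range N, b i) ^ q ≤ C * ∑ i ∈ Finset.range N, √2 ^ i * b i ^ q := by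
  have h2 : (1 : ℝ) < √2 := by
    rw [Real.lt_sqrt (by norm_num)]; norm_num
  -- Each `b i` is at most `w ^ i` times the `q`-th root of the weighted sum.
  set w : ℝ := (√2 ^ (1 / q))⁻¹ with hw
  have hr1 : (1 : ℝ) < √2 ^ (1 / q) := Real.one_lt_rpow h2 (by positivity)
  have hw0 : 0 < w := by positivity
  have hw1 : w < 1 := inv_lt_one_of_one_lt₀ hr1
  have hwq : w ^ q = (√2)⁻¹ := by
    rw [hw, Real.inv_rpow (by positivity), ← Real.rpow_mul (by positivity)]
    rw [one_div_mul_cancel hq.ne', Real.rpow_one]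
  have h1w : 0 < 1 - w := by linarith
  refine ⟨((1 - w)⁻¹) ^ q, by positivity, fun N b hb => ?_⟩
  set S := ∑ i ∈ Finset.range N, √2 ^ i * b i ^ q with hS
  have hS0 : 0 ≤ S := Finset.sum_nonneg fun i _ => mul_nonneg (by positivity)
    (Real.rpow_nonneg (hb i) _)
  have key : ∀ i ∈ Finset.range N, b i ≤ w ^ i * S ^ (1 / q) := by
    intro i hi
    have h1 : √2 ^ i * b i ^ q ≤ S :=
      Finset.single_le_sum (f := fun i => √2 ^ i * b i ^ q)
        (fun i _ => mul_nonneg (by positivity) (Real.rpow_nonneg (hb i) _)) hi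
    rw [← Real.rpow_le_rpow_iff (hb i) (by positivity) hq, Real.mul_rpow (by positivity)
      (by positivity), ← Real.rpow_mul hS0, one_div_mul_cancel hq.ne', Real.rpow_one,
      ← Real.rpow_natCast, ← Real.rpow_mul hw0.le, mul_comm (i : ℝ), Real.rpow_mul hw0.le,
      hwq, Real.rpow_natCast, inv_pow,
      inv_mul_eq_div, le_div_iff₀ (by positivity)]
    linarith
  have hsum : ∑ i ∈ Finset.range N, b i ≤ (1 - w)⁻¹ * S ^ (1 / q) := by
    refine (Finset.sum_le_sum key).trans ?_
    rw [← Finset.sum_mul]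
    refine mul_le_mul_of_nonneg_right ?_ (by positivity)
    rw [← tsum_geometric_of_lt_one hw0.le hw1]
    exact (summable_geometric_of_lt_one hw0.le hw1).sum_le_tsum _ (fun i _ => by positivity)
  calc _ ≤ ((1 - w)⁻¹ * S ^ (1 / q)) ^ q :=
        Real.rpow_le_rpow (Finset.sum_nonneg fun i _ => hb i) hsum hq.le
    _ = _ := by
      rw [Real.mul_rpow (by positivity) (by positivity), ← Real.rpow_mul hS0,
        one_div_mul_cancel hq.ne', Real.rpow_one]

/-- Bernoulli's inequality in homogeneous form: `x ^ p` lies above its tangent at `a + c`. -/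
lemma add_rpow_le_rpow_add_mul {p a c : ℝ} (hp : 1 ≤ p) (ha : 0 ≤ a) (hc : 0 ≤ c) :
    (a + c) ^ p ≤ c ^ p + p * (a * (a + c) ^ (p - 1)) := by
  rcases (add_nonneg ha hc).eq_or_lt with h | h
  · have ha0 : a = 0 := by linarith
    simp [ha0]
  have hB := one_add_mul_self_le_rpow_one_add (s := -(a / (a + c))) (p := p)
    (by rw [neg_le_neg_iff, div_le_one h]; linarith) hp
  have e1 : 1 + -(a / (a + c)) = c / (a + c) := by field_simp; ring
  rw [e1, Real.div_rpow hc h.le, le_div_iff₀ (by positivity)] at hB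
  have e2 : (a + c) ^ p = (a + c) ^ (p - 1) * (a + c) := by
    rw [← Real.rpow_add_one h.ne']; ring_nf
  have e3 : (1 + p * -(a / (a + c))) * (a + c) ^ p
      = (a + c) ^ p - p * (a * (a + c) ^ (p - 1)) := by
    rw [e2]; field_simp
    ring
  linarith

/-- The algebraic core of Wolff's inequality. The exponential weight `√2 ^ (k - j)` costs nothing
later, because the integral of the `(j, k)` term gains `2 ^ (k - j)`. -/
lemma rpow_sum_le_sum_sum {p : ℝ} (hp : 1 < p) :
    ∃ C : ℝ, 0 < C ∧ ∀ (N : ℕ) (b : ℕ → ℝ), (∀ i, 0 ≤ b i) →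
      (∑ i ∈ Finset.range N, b i) ^ p ≤
        C * ∑ k ∈ Finset.range N, ∑ j ∈ Finset.range (k + 1),
          √2 ^ (k - j) * b j * b k ^ (p - 1) := by
  obtain ⟨C, hC, hsum⟩ := rpow_sum_le_sum_pow_mul_rpow (sub_pos.2 hp)
  have hp0 : 0 < p := by linarith
  refine ⟨p * C, by positivity, fun N => ?_⟩
  induction N with
  | zero => intro b hb; simp [Real.zero_rpow hp0.ne']
  | succ N ih =>
    intro b hb
    have h1 := ih (fun i => b (i + 1)) (fun i => hb _)
    have h2 := hsum (N + 1) b hb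
    have h3 := add_rpow_le_rpow_add_mul hp.le (hb 0)
      (Finset.sum_nonneg fun (i : ℕ) (_ : i ∈ Finset.range N) => hb (i + 1))
    have e1 : ∑ i ∈ Finset.range (N + 1), b i = b 0 + ∑ i ∈ Finset.range N, b (i + 1) := by
      rw [Finset.sum_range_succ', add_comm]
    have e2 : ∑ k ∈ Finset.range (N + 1), ∑ j ∈ Finset.range (k + 1),
          √2 ^ (k - j) * b j * b k ^ (p - 1) =
        (∑ k ∈ Finset.range N, ∑ j ∈ Finset.range (k + 1),
          √2 ^ (k - j) * b (j + 1) * b (k + 1) ^ (p - 1)) +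
        b 0 * ∑ k ∈ Finset.range (N + 1), √2 ^ k * b k ^ (p - 1) := by
      have : ∀ k, ∑ j ∈ Finset.range (k + 1), √2 ^ (k - j) * b j * b k ^ (p - 1) =
          (∑ j ∈ Finset.range k, √2 ^ (k - (j + 1)) * b (j + 1) * b k ^ (p - 1)) +
            b 0 * (√2 ^ k * b k ^ (p - 1)) := by
        intro k
        rw [Finset.sum_range_succ']
        simp only [Nat.sub_zero]
        ring
      simp_rw [this, Finset.sum_add_distrib, ← Finset.mul_sum]
      congr 1
      rw [Finset.sum_range_succ' (fun k => ∑ j ∈ Finset.range k, _)]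
      simp
    rw [e1] at h2 ⊢
    rw [e2, mul_add]
    refine h3.trans (add_le_add h1 ?_)
    have := mul_le_mul_of_nonneg_left h2 (mul_nonneg hp0.le (hb 0))
    linarith

lemma sum_sum_geometric_le {q : ℝ} (hq0 : 0 ≤ q) (hq1 : q < 1) (M : ℕ) (a : ℕ → ℝ)
    (ha : ∀ i, 0 ≤ a i) :
    ∑ k ∈ Finset.range M, ∑ j ∈ Finset.range (k + 1), q ^ (k - j) * a j ≤
      (1 - q)⁻¹ * ∑ j ∈ Finset.range M, a j := by
  rw [Finset.sum_comm' (t' := Finset.range M) (s' := fun j => Finset.Ico j M)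
    (by intro x y; simp; omega), Finset.mul_sum]
  refine Finset.sum_le_sum fun j _ => ?_
  rw [← Finset.sum_mul, Finset.sum_Ico_eq_sum_range]
  refine mul_le_mul_of_nonneg_right ?_ (ha j)
  simp only [Nat.add_sub_cancel_left]
  rw [← tsum_geometric_of_lt_one hq0 hq1]
  exact (summable_geometric_of_lt_one hq0 hq1).sum_le_tsum _ (fun i _ => by positivity)

/-! ### Mollified masses of balls -/

/-- A fixed smooth bump function, equal to `1` on the ball of radius `1/2` about the origin and
supported in the unit ball. -/
def unitBump (n : ℕ) : ContDiffBump (0 : EuclideanSpace ℝ (Fin n)) :=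
  ⟨1 / 2, 1, by norm_num, by norm_num⟩

/-- The average `ρ⁻ⁿ ∫ ψ((x - y)/ρ) μ(B(y, ρ))^s dy`, a smooth substitute for
`x ↦ μ(B(x, ρ))^s`. The power is taken before the mollification, so that smoothness does not depend
on `s`. -/
def smoothedMass (μ : Measure (EuclideanSpace ℝ (Fin n))) (s ρ : ℝ)
    (x : EuclideanSpace ℝ (Fin n)) : ℝ :=
  (ρ ^ n)⁻¹ * ∫ y, μ.real (Metric.ball y ρ) ^ s * unitBump n (ρ⁻¹ • (x - y))

lemma measurable_measureReal_ball (μ : Measure (EuclideanSpace ℝ (Fin n))) [IsFiniteMeasure μ]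
    (ρ : ℝ) : Measurable fun y => μ.real (Metric.ball y ρ) := by
  have h : MeasurableSet {z : EuclideanSpace ℝ (Fin n) × EuclideanSpace ℝ (Fin n) |
      dist z.2 z.1 < ρ} :=
    (isOpen_lt (by fun_prop) (by fun_prop)).measurableSet
  exact (measurable_measure_prodMk_left (ν := μ) h).ennreal_toReal

lemma unitBump_eq_zero {z : EuclideanSpace ℝ (Fin n)} (h : 1 ≤ ‖z‖) : unitBump n z = 0 := by
  apply (unitBump n).zero_of_le_dist
  simpa [unitBump] using h

lemma unitBump_eq_one {z : EuclideanSpace ℝ (Fin n)} (h : ‖z‖ ≤ 1 / 2) : unitBump n z = 1 := by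
  apply (unitBump n).one_of_mem_closedBall
  simpa [unitBump] using h

lemma locallyIntegrable_rpow_measureReal_ball (μ : Measure (EuclideanSpace ℝ (Fin n)))
    [IsFiniteMeasure μ] {s : ℝ} (hs : 0 ≤ s) (ρ : ℝ) :
    LocallyIntegrable fun y => μ.real (Metric.ball y ρ) ^ s := by
  have hc : LocallyIntegrable (fun _ : EuclideanSpace ℝ (Fin n) => μ.real univ ^ s) volume :=
    (continuous_const).locallyIntegrable
  refine hc.mono ((measurable_measureReal_ball μ ρ).pow_const s).aestronglyMeasurable ?_
  refine Eventually.of_forall fun y => ?_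
  rw [Real.norm_of_nonneg (by positivity), Real.norm_of_nonneg (by positivity)]
  exact Real.rpow_le_rpow measureReal_nonneg (measureReal_mono (subset_univ _)) hs

lemma hasCompactSupport_unitBump_smul {ρ : ℝ} (hρ : 0 < ρ) :
    HasCompactSupport fun z => unitBump n (ρ⁻¹ • z) :=
  (unitBump n).hasCompactSupport.comp_homeomorph (Homeomorph.smulOfNeZero ρ⁻¹ (inv_ne_zero hρ.ne'))

lemma contDiff_unitBump_smul (ρ : ℝ) :
    ContDiff ℝ ((⊤ : ℕ∞) : WithTop ℕ∞) fun z => unitBump n (ρ⁻¹ • z) :=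
  (unitBump n).contDiff.comp (contDiff_const_smul _)

lemma contDiff_smoothedMass (μ : Measure (EuclideanSpace ℝ (Fin n))) [IsFiniteMeasure μ] {s ρ : ℝ}
    (hs : 0 ≤ s) (hρ : 0 < ρ) :
    ContDiff ℝ ((⊤ : ℕ∞) : WithTop ℕ∞) (smoothedMass μ s ρ) := by
  have h := (hasCompactSupport_unitBump_smul (n := n) hρ).contDiff_convolution_right
    (ContinuousLinearMap.mul ℝ ℝ) (μ := volume) (n := ⊤)
    (locallyIntegrable_rpow_measureReal_ball μ hs ρ) (contDiff_unitBump_smul ρ)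
  exact contDiff_const.mul h

lemma integrable_smoothedMass_integrand (μ : Measure (EuclideanSpace ℝ (Fin n)))
    [IsFiniteMeasure μ] {s ρ : ℝ} (hs : 0 ≤ s) (hρ : 0 < ρ) (x : EuclideanSpace ℝ (Fin n)) :
    Integrable fun y => μ.real (Metric.ball y ρ) ^ s * unitBump n (ρ⁻¹ • (x - y)) := by
  have h := (hasCompactSupport_unitBump_smul (n := n) hρ).convolutionExists_right
    (ContinuousLinearMap.mul ℝ ℝ) (μ := volume)
    (locallyIntegrable_rpow_measureReal_ball μ hs ρ) (contDiff_unitBump_smul ρ).continuous x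
  simpa [ConvolutionExistsAt] using h

lemma smoothedMass_nonneg (μ : Measure (EuclideanSpace ℝ (Fin n))) {s ρ : ℝ}
    (hρ : 0 < ρ) (x : EuclideanSpace ℝ (Fin n)) : 0 ≤ smoothedMass μ s ρ x :=
  mul_nonneg (by positivity) (integral_nonneg fun y => mul_nonneg (by positivity)
    (unitBump n).nonneg)

lemma norm_inv_smul {ρ : ℝ} (hρ : 0 < ρ) (z : EuclideanSpace ℝ (Fin n)) :
    ‖ρ⁻¹ • z‖ = ‖z‖ / ρ := by
  rw [norm_smul, norm_inv, Real.norm_of_nonneg hρ.le, inv_mul_eq_div]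

lemma smoothedMass_eq_zero {μ : Measure (EuclideanSpace ℝ (Fin n))} [IsFiniteMeasure μ] {s ρ : ℝ}
    (hs : 0 < s) (hρ : 0 < ρ) {x : EuclideanSpace ℝ (Fin n)} (h : μ (Metric.ball x (2 * ρ)) = 0) :
    smoothedMass μ s ρ x = 0 := by
  rw [smoothedMass]
  convert mul_zero _
  rw [← integral_zero (EuclideanSpace ℝ (Fin n)) ℝ]
  congr 1
  ext y
  rcases le_or_gt ρ ‖x - y‖ with hy | hy
  · rw [unitBump_eq_zero, mul_zero]
    rw [norm_inv_smul hρ]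
    exact (one_le_div hρ).2 hy
  · have : μ (Metric.ball y ρ) = 0 := by
      refine measure_mono_null (Metric.ball_subset_ball' ?_) h
      rw [dist_comm, dist_eq_norm]
      linarith
    simp [measureReal_def, this, hs.ne']

lemma volumeReal_ball_mul (x : EuclideanSpace ℝ (Fin n)) {ρ : ℝ} (hρ : 0 < ρ) (t : ℝ) :
    volume.real (Metric.ball x (ρ * t)) =
      ρ ^ n * volume.real (Metric.ball (0 : EuclideanSpace ℝ (Fin n)) t) := by
  rw [measureReal_def, Measure.addHaar_ball_mul_of_pos _ x hρ, ENNReal.toReal_mul,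
    ENNReal.toReal_ofReal (by positivity), finrank_euclideanSpace_fin, measureReal_def]

/-- A positive lower bound for `smoothedMass`. The constant is the volume of the ball of
radius `1/2`. -/
lemma le_smoothedMass (μ : Measure (EuclideanSpace ℝ (Fin n))) [IsFiniteMeasure μ] {s ρ : ℝ}
    (hs : 0 < s) (hρ : 0 < ρ) (x : EuclideanSpace ℝ (Fin n)) :
    volume.real (Metric.ball (0 : EuclideanSpace ℝ (Fin n)) (1 / 2)) *
      μ.real (Metric.ball x (ρ / 2)) ^ s ≤ smoothedMass μ s ρ x := by
  have hv : volume.real (Metric.ball x (ρ / 2)) =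
      ρ ^ n * volume.real (Metric.ball (0 : EuclideanSpace ℝ (Fin n)) (1 / 2)) := by
    rw [div_eq_mul_one_div]
    exact volumeReal_ball_mul x hρ _
  have h1 : ∫ y in Metric.ball x (ρ / 2), μ.real (Metric.ball x (ρ / 2)) ^ s ≤
      ∫ y, μ.real (Metric.ball y ρ) ^ s * unitBump n (ρ⁻¹ • (x - y)) := by
    rw [← integral_indicator Metric.isOpen_ball.measurableSet]
    refine integral_mono ?_ (integrable_smoothedMass_integrand μ hs.le hρ x) fun y => ?_
    · rw [integrable_indicator_iff Metric.isOpen_ball.measurableSet]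
      exact integrableOn_const measure_ball_lt_top.ne
    · by_cases hy : y ∈ Metric.ball x (ρ / 2)
      · rw [Set.indicator_of_mem hy, unitBump_eq_one, mul_one]
        · refine Real.rpow_le_rpow measureReal_nonneg (measureReal_mono ?_) hs.le
          refine Metric.ball_subset_ball' ?_
          have := Metric.mem_ball'.1 hy
          linarith
        · rw [norm_inv_smul hρ, div_le_iff₀ hρ, ← dist_eq_norm]
          have := Metric.mem_ball'.1 hy
          linarith
      · rw [Set.indicator_of_notMem hy]
        exact mul_nonneg (by positivity) (unitBump n).nonneg
  rw [setIntegral_const, smul_eq_mul, hv] at h1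
  rw [smoothedMass, inv_mul_eq_div, le_div_iff₀ (by positivity)]
  linarith

/-- The Lipschitz constant of `smoothedMass` at `x` is at most `C ρ⁻¹ μ(B(x, 4ρ))^s`. -/
lemma exists_norm_fderiv_smoothedMass_le (n : ℕ) :
    ∃ C : ℝ, 0 < C ∧ ∀ (μ : Measure (EuclideanSpace ℝ (Fin n))) [IsFiniteMeasure μ] (s ρ : ℝ),
      0 < s → 0 < ρ → ∀ x, ‖fderiv ℝ (smoothedMass μ s ρ) x‖ ≤
        C * (ρ⁻¹ * μ.real (Metric.ball x (4 * ρ)) ^ s) := by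
  obtain ⟨L, hL⟩ := ((unitBump n).contDiff (n := 1)).lipschitzWith_of_hasCompactSupport
    (unitBump n).hasCompactSupport (by norm_num)
  set v := volume.real (Metric.ball (0 : EuclideanSpace ℝ (Fin n)) 2) with hv
  refine ⟨(L + 1) * (v + 1), by positivity, fun μ _ s ρ hs hρ x => ?_⟩
  set m := μ.real (Metric.ball x (4 * ρ)) ^ s with hm
  have hm0 : 0 ≤ m := by positivity
  have hball : volume.real (Metric.ball x (2 * ρ)) = ρ ^ n * v := by
    rw [mul_comm 2 ρ]
    exact volumeReal_ball_mul x hρ _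
  have key : ∀ᶠ x' in 𝓝 x, ‖smoothedMass μ s ρ x' - smoothedMass μ s ρ x‖ ≤
      (L * v * (ρ⁻¹ * m)) * ‖x' - x‖ := by
    filter_upwards [Metric.ball_mem_nhds x hρ] with x' hx'
    rw [smoothedMass, smoothedMass, ← mul_sub, ← integral_sub
      (integrable_smoothedMass_integrand μ hs.le hρ x')
      (integrable_smoothedMass_integrand μ hs.le hρ x), norm_mul,
      Real.norm_of_nonneg (by positivity : 0 ≤ (ρ ^ n)⁻¹)]
    have hbd : ‖∫ y, (μ.real (Metric.ball y ρ) ^ s * unitBump n (ρ⁻¹ • (x' - y)) -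
        μ.real (Metric.ball y ρ) ^ s * unitBump n (ρ⁻¹ • (x - y)))‖ ≤
        ∫ y in Metric.ball x (2 * ρ), m * (L * (ρ⁻¹ * ‖x' - x‖)) := by
      rw [← integral_indicator Metric.isOpen_ball.measurableSet]
      refine norm_integral_le_of_norm_le ?_ (Eventually.of_forall fun y => ?_)
      · rw [integrable_indicator_iff Metric.isOpen_ball.measurableSet]
        exact integrableOn_const measure_ball_lt_top.ne
      · by_cases hy : y ∈ Metric.ball x (2 * ρ)
        · rw [Set.indicator_of_mem hy, ← mul_sub, norm_mul]
          refine mul_le_mul ?_ ?_ (norm_nonneg _) hm0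
          · rw [Real.norm_of_nonneg (by positivity)]
            refine Real.rpow_le_rpow measureReal_nonneg (measureReal_mono ?_) hs.le
            refine Metric.ball_subset_ball' ?_
            have := Metric.mem_ball.1 hy
            linarith
          · refine (hL.norm_sub_le _ _).trans ?_
            refine mul_le_mul_of_nonneg_left ?_ L.2
            rw [← smul_sub, norm_inv_smul hρ, inv_mul_eq_div]
            simp
        · have hy1 : 2 * ρ ≤ ‖x - y‖ := by
            rw [← dist_eq_norm, dist_comm]
            simpa using hy
          have hy2 : ρ ≤ ‖x' - y‖ := by
            have h1 : ‖x' - x‖ < ρ := by rw [← dist_eq_norm]; exact hx'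
            have h2 : ‖x - y‖ ≤ ‖x' - x‖ + ‖x' - y‖ := by
              rw [norm_sub_rev x' x]
              exact (norm_sub_le_norm_sub_add_norm_sub x x' y)
            linarith
          rw [Set.indicator_of_notMem hy, unitBump_eq_zero, unitBump_eq_zero]
          · simp
          · rw [norm_inv_smul hρ, one_le_div hρ]; linarith
          · rw [norm_inv_smul hρ, one_le_div hρ]; exact hy2
    rw [setIntegral_const, smul_eq_mul, hball] at hbd
    calc _ ≤ (ρ ^ n)⁻¹ * (ρ ^ n * v * (m * (L * (ρ⁻¹ * ‖x' - x‖)))) :=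
          mul_le_mul_of_nonneg_left hbd (by positivity)
      _ = _ := by field_simp
  refine (norm_fderiv_le_of_lip' ℝ (by positivity) key).trans ?_
  refine mul_le_mul_of_nonneg_right ?_ (by positivity)
  have : (0:ℝ) ≤ L := L.2
  have : 0 ≤ v := measureReal_nonneg
  nlinarith

/-! ### A localized Wolff inequality -/

/-- The quantity `(μ(B(x, r)) / ρᵃ)^s`. With `a = n - p` it is a dyadic piece of the Wolff
potential; with `a = n - 1` it is a dyadic piece of a bound for its gradient. -/
def massRatio (μ : Measure (EuclideanSpace ℝ (Fin n))) (s a ρ r : ℝ)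
    (x : EuclideanSpace ℝ (Fin n)) : ℝ :=
  (μ.real (Metric.ball x r) / ρ ^ a) ^ s

lemma massRatio_nonneg (μ : Measure (EuclideanSpace ℝ (Fin n))) {s a ρ r : ℝ} (hρ : 0 < ρ)
    (x : EuclideanSpace ℝ (Fin n)) : 0 ≤ massRatio μ s a ρ r x := by
  unfold massRatio; positivity

lemma measurable_massRatio (μ : Measure (EuclideanSpace ℝ (Fin n))) [IsFiniteMeasure μ]
    (s a ρ r : ℝ) : Measurable (massRatio μ s a ρ r) :=
  ((measurable_measureReal_ball μ r).div_const _).pow_const s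

lemma massRatio_mono {μ : Measure (EuclideanSpace ℝ (Fin n))} [IsFiniteMeasure μ]
    {s a ρ r r' : ℝ} (hs : 0 ≤ s) (hρ : 0 < ρ) {x x' : EuclideanSpace ℝ (Fin n)}
    (h : r + dist x x' ≤ r') : massRatio μ s a ρ r x ≤ massRatio μ s a ρ r' x' := by
  unfold massRatio
  have := measureReal_mono (μ := μ) (Metric.ball_subset_ball' h)
  gcongr

lemma massRatio_le_univ {μ : Measure (EuclideanSpace ℝ (Fin n))} [IsFiniteMeasure μ]
    {s a ρ r : ℝ} (hs : 0 ≤ s) (hρ : 0 < ρ) (x : EuclideanSpace ℝ (Fin n)) :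
    massRatio μ s a ρ r x ≤ (μ.real univ / ρ ^ a) ^ s := by
  unfold massRatio
  have := measureReal_mono (μ := μ) (subset_univ (Metric.ball x r))
  gcongr

lemma measurable_setLIntegral_inter_ball (μ : Measure (EuclideanSpace ℝ (Fin n)))
    [SFinite μ] {f : EuclideanSpace ℝ (Fin n) → ℝ≥0∞} (hf : Measurable f)
    {F : Set (EuclideanSpace ℝ (Fin n))} (hF : MeasurableSet F) (δ : ℝ) :
    Measurable fun y => ∫⁻ x in F ∩ Metric.ball y δ, f x ∂μ := by
  have hm : MeasurableSet {z : EuclideanSpace ℝ (Fin n) × EuclideanSpace ℝ (Fin n) |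
      z.1 ∈ F ∧ dist z.1 z.2 < δ} :=
    (measurable_fst hF).inter
      (isOpen_lt (continuous_fst.dist continuous_snd) continuous_const).measurableSet
  have := ((hf.comp measurable_fst).indicator hm).lintegral_prod_left' (μ := μ)
  convert this using 2 with y
  rw [← lintegral_indicator (hF.inter Metric.isOpen_ball.measurableSet)]
  rfl

lemma setLIntegral_mul_measure_ball (μ ν : Measure (EuclideanSpace ℝ (Fin n)))
    [SFinite μ] [SFinite ν] {f : EuclideanSpace ℝ (Fin n) → ℝ≥0∞} (hf : Measurable f)
    (F : Set (EuclideanSpace ℝ (Fin n))) (δ : ℝ) :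
    ∫⁻ x in F, f x * μ (Metric.ball x δ) ∂ν =
      ∫⁻ y, ∫⁻ x in F ∩ Metric.ball y δ, f x ∂ν ∂μ := by
  have hm : MeasurableSet {z : EuclideanSpace ℝ (Fin n) × EuclideanSpace ℝ (Fin n) |
      dist z.1 z.2 < δ} := (isOpen_lt (by fun_prop) (by fun_prop)).measurableSet
  have h1 : ∀ x, f x * μ (Metric.ball x δ) =
      ∫⁻ y, ({z : EuclideanSpace ℝ (Fin n) × EuclideanSpace ℝ (Fin n) |
        dist z.1 z.2 < δ}.indicator (fun z => f z.1)) (x, y) ∂μ := by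
    intro x
    rw [← lintegral_indicator_const Metric.isOpen_ball.measurableSet]
    congr 1
    ext y
    simp only [Set.indicator, Metric.mem_ball, mem_ofPred_eq, dist_comm y x]
  simp_rw [h1]
  have hu : Measurable (Function.uncurry fun x y =>
      ({z : EuclideanSpace ℝ (Fin n) × EuclideanSpace ℝ (Fin n) |
        dist z.1 z.2 < δ}.indicator (fun z => f z.1)) (x, y)) :=
    (hf.comp measurable_fst).indicator hm
  rw [lintegral_lintegral_swap hu.aemeasurable]
  congr 1
  ext y
  rw [inter_comm, ← Measure.restrict_restrict Metric.isOpen_ball.measurableSet,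
    ← lintegral_indicator Metric.isOpen_ball.measurableSet]
  rfl

lemma sum_ite_le_of_forall {P : ℕ → Prop} [DecidablePred P] {h : ℕ → ℝ} {B : ℝ} (hB : 0 ≤ B)
    (N : ℕ) (H : ∀ M < N, P M → ∑ k ∈ Finset.range (M + 1), h k ≤ B) (h0 : ∀ k, 0 ≤ h k) :
    ∑ k ∈ Finset.range N, (if P k then h k else 0) ≤ B := by
  induction N with
  | zero => simpa
  | succ N ih =>
    by_cases hP : P N
    · refine le_trans (Finset.sum_le_sum fun k _ => ?_) (H N (Nat.lt_succ_self N) hP)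
      split_ifs
      · exact le_rfl
      · exact h0 k
    · rw [Finset.sum_range_succ, if_neg hP, add_zero]
      exact ih fun M hM => H M (by omega)

lemma div_two_pow_rpow {R : ℝ} (hR : 0 < R) (m : ℝ) (a : ℝ) (i j : ℕ) :
    m / (R / 2 ^ (i + j)) ^ a = (2 ^ j) ^ a * (m / (R / 2 ^ i) ^ a) := by
  have : R / 2 ^ i = 2 ^ j * (R / 2 ^ (i + j)) := by
    rw [pow_add]; field_simp
  rw [this, Real.mul_rpow (by positivity) (by positivity)]
  field_simp

/-- A point `x'` at which the dyadic Wolff sum is at most `Λ` controls the dyadic Wolff sums at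
nearby points `y`, over the scales not smaller than the distance from `x'` to `y`. The five coarsest
scales are not seen from `x'`, and are controlled by the total mass. -/
lemma sum_massRatio_le_of_near {μ : Measure (EuclideanSpace ℝ (Fin n))} [IsFiniteMeasure μ]
    {s a R Λ : ℝ} (hs : 0 < s) (ha : 0 ≤ a) (hR : 0 < R) {N M : ℕ} (hM : M < N)
    {x' y : EuclideanSpace ℝ (Fin n)} (hxy : dist y x' < 4 * (R / 2 ^ M))
    (hx' : ∑ i ∈ Finset.range N, massRatio μ s a (R / 2 ^ i) (R / 2 ^ i / 2) x' ≤ Λ)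
    (hΛ : (μ.real univ / R ^ a) ^ s ≤ Λ) :
    ∑ j ∈ Finset.range (M + 1), massRatio μ s a (R / 2 ^ j) (8 * (R / 2 ^ j)) y ≤
      6 * (((32 : ℝ) ^ a) ^ s * Λ) := by
  -- The scale `5 + i` at `y` is compared with the scale `i` at `x'`, since `16 = 2⁵ / 2`.
  set A : ℕ → ℝ := fun j => if j < M + 1 then massRatio μ s a (R / 2 ^ j) (8 * (R / 2 ^ j)) y
    else 0 with hA
  have hA0 : ∀ j, 0 ≤ A j := fun j => by
    simp only [hA]; split_ifs
    · exact massRatio_nonneg _ (by positivity) _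
    · exact le_rfl
  have hΛ0 : 0 ≤ Λ := le_trans (by positivity) hΛ
  have e1 : ∑ j ∈ Finset.range (M + 1), massRatio μ s a (R / 2 ^ j) (8 * (R / 2 ^ j)) y =
      ∑ j ∈ Finset.range (M + 1), A j :=
    Finset.sum_congr rfl fun j hj => by simp only [hA]; rw [if_pos (Finset.mem_range.1 hj)]
  have h1 : ∀ j ∈ Finset.range 5, A j ≤ ((32 : ℝ) ^ a) ^ s * Λ := by
    intro j hj
    have hj : j < 5 := Finset.mem_range.1 hj
    simp only [hA]
    split_ifs
    · refine (massRatio_le_univ hs.le (by positivity) _).trans ?_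
      have := div_two_pow_rpow hR (μ.real univ) a 0 j
      rw [zero_add, pow_zero, div_one] at this
      rw [this, Real.mul_rpow (by positivity) (by positivity)]
      have h32 : (2 : ℝ) ^ j ≤ 32 := by
        calc (2 : ℝ) ^ j ≤ 2 ^ 5 := pow_le_pow_right₀ (by norm_num) hj.le
          _ = 32 := by norm_num
      gcongr
    · positivity
  have h2 : ∀ i ∈ Finset.range (M + 1), A (5 + i) ≤
      ((32 : ℝ) ^ a) ^ s * massRatio μ s a (R / 2 ^ i) (R / 2 ^ i / 2) x' := by
    intro i hi
    simp only [hA]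
    split_ifs with hlt
    · have h16 : R / 2 ^ i / 2 = 16 * (R / 2 ^ (5 + i)) := by
        rw [pow_add]; field_simp; norm_num
      have hMi : R / 2 ^ M ≤ R / 2 ^ (5 + i) :=
        div_le_div_of_nonneg_left hR.le (by positivity)
          (pow_le_pow_right₀ (by norm_num) (by omega))
      refine (massRatio_mono (x' := x') (r' := R / 2 ^ i / 2) hs.le (by positivity) ?_).trans ?_
      · rw [h16]; linarith [show 0 < R / 2 ^ (5 + i) by positivity]
      · unfold massRatio
        rw [add_comm 5 i, div_two_pow_rpow hR, Real.mul_rpow (by positivity) (by positivity)]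
        norm_num
    · exact mul_nonneg (by positivity) (massRatio_nonneg _ (by positivity) _)
  rw [e1]
  calc ∑ j ∈ Finset.range (M + 1), A j ≤ ∑ j ∈ Finset.range (5 + (M + 1)), A j :=
        Finset.sum_le_sum_of_subset_of_nonneg
          (Finset.range_subset_range.2 (by omega)) fun j _ _ => hA0 j
    _ = ∑ j ∈ Finset.range 5, A j + ∑ i ∈ Finset.range (M + 1), A (5 + i) :=
        Finset.sum_range_add _ _ _
    _ ≤ 5 * (((32 : ℝ) ^ a) ^ s * Λ) + ((32 : ℝ) ^ a) ^ s * Λ := by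
        refine add_le_add ?_ ?_
        · refine (Finset.sum_le_sum h1).trans ?_
          simp
        · refine (Finset.sum_le_sum h2).trans ?_
          rw [← Finset.mul_sum]
          refine mul_le_mul_of_nonneg_left (le_trans ?_ hx') (by positivity)
          exact Finset.sum_le_sum_of_subset_of_nonneg
            (Finset.range_subset_range.2 (by omega))
            fun j _ _ => massRatio_nonneg _ (by positivity) _
    _ = _ := by ring

lemma mul_massRatio {μ : Measure (EuclideanSpace ℝ (Fin n))} {p ρ r : ℝ} (hp : 1 < p)
    (hρ : 0 < ρ) (x : EuclideanSpace ℝ (Fin n)) :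
    ρ * massRatio μ (1 / (p - 1)) (n - 1) ρ r x = massRatio μ (1 / (p - 1)) (n - p) ρ r x := by
  unfold massRatio
  have hp1 : p - 1 ≠ 0 := by linarith
  have e : ((n : ℝ) - p) = (n - 1) - (p - 1) := by ring
  rw [e, Real.rpow_sub hρ ((n : ℝ) - 1), div_div_eq_mul_div, mul_div_right_comm,
    Real.mul_rpow (by positivity) (by positivity), mul_comm ρ, ← Real.rpow_mul hρ.le,
    mul_one_div_cancel hp1, Real.rpow_one]

/-- **Localized Wolff inequality.** Where the dyadic Wolff sum of `μ` is at most `Λ`, the `p`-energy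
of the corresponding gradient sum is at most a multiple of `Λ μ(ℝⁿ)`. -/
lemma exists_setLIntegral_rpow_sum_massRatio_le (n : ℕ) {p : ℝ} (hp : 1 < p) (hpn : p ≤ n) :
    ∃ C : ℝ, 0 < C ∧ ∀ (μ : Measure (EuclideanSpace ℝ (Fin n))) [IsFiniteMeasure μ] (R Λ : ℝ)
      (N : ℕ) (F : Set (EuclideanSpace ℝ (Fin n))), 0 < R → MeasurableSet F →
      (∀ x ∈ F, ∑ i ∈ Finset.range N,
        massRatio μ (1 / (p - 1)) (n - p) (R / 2 ^ i) (R / 2 ^ i / 2) x ≤ Λ) →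
      (μ.real univ / R ^ (n - p)) ^ (1 / (p - 1)) ≤ Λ →
      ∫⁻ x in F, ENNReal.ofReal ((∑ i ∈ Finset.range N,
        massRatio μ (1 / (p - 1)) (n - 1) (R / 2 ^ i) (4 * (R / 2 ^ i)) x) ^ p) ≤
        ENNReal.ofReal (C * Λ) * μ univ := by
  classical
  obtain ⟨C₂, hC₂, halg⟩ := rpow_sum_le_sum_sum hp
  set s := 1 / (p - 1) with hs_def
  have hp1 : 0 < p - 1 := by linarith
  have hs : 0 < s := by positivity
  set v := volume.real (Metric.ball (0 : EuclideanSpace ℝ (Fin n)) 4) with hv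
  have hv0 : 0 < v :=
    ENNReal.toReal_pos (Metric.measure_ball_pos _ _ (by norm_num)).ne' measure_ball_lt_top.ne
  have hq1 : √2 / 2 < 1 := by
    rw [div_lt_one (by norm_num), Real.sqrt_lt' (by norm_num)]; norm_num
  have hq2 : 0 < 1 - √2 / 2 := by linarith
  refine ⟨C₂ * v * ((1 - √2 / 2)⁻¹ * (6 * ((32 : ℝ) ^ ((n : ℝ) - p)) ^ s)), by positivity, ?_⟩
  intro μ _ R Λ N F hR hF hFΛ hΛ
  have hΛ0 : 0 ≤ Λ := le_trans (by positivity) hΛ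
  set b : ℕ → EuclideanSpace ℝ (Fin n) → ℝ :=
    fun i => massRatio μ s (n - 1) (R / 2 ^ i) (4 * (R / 2 ^ i)) with hb
  have hb0 : ∀ i x, 0 ≤ b i x := fun i x => massRatio_nonneg _ (by positivity) _
  have hbm : ∀ i, Measurable (b i) := fun i => measurable_massRatio _ _ _ _ _
  -- `H k x * μ (ball x (4ρ_k))` collects the terms of the double sum with larger index `k`.
  set H : ℕ → EuclideanSpace ℝ (Fin n) → ℝ := fun k x =>
    C₂ * (∑ j ∈ Finset.range (k + 1), √2 ^ (k - j) * b j x) / (R / 2 ^ k) ^ ((n : ℝ) - 1) with hH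
  have hH0 : ∀ k x, 0 ≤ H k x := fun k x => by
    have : 0 ≤ ∑ j ∈ Finset.range (k + 1), √2 ^ (k - j) * b j x :=
      Finset.sum_nonneg fun j _ => mul_nonneg (by positivity) (hb0 _ _)
    positivity
  have hHm : ∀ k, Measurable (H k) := fun k =>
    ((Finset.measurable_fun_sum _ fun j _ => (hbm j).const_mul _).const_mul _).div_const _
  have step1 : ∀ x, ENNReal.ofReal ((∑ i ∈ Finset.range N, b i x) ^ p) ≤
      ∑ k ∈ Finset.range N, ENNReal.ofReal (H k x) * μ (Metric.ball x (4 * (R / 2 ^ k))) := by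
    intro x
    have hterm : ∀ k, H k x * μ.real (Metric.ball x (4 * (R / 2 ^ k))) =
        C₂ * ∑ j ∈ Finset.range (k + 1), √2 ^ (k - j) * b j x * b k x ^ (p - 1) := by
      intro k
      have : b k x ^ (p - 1) =
          μ.real (Metric.ball x (4 * (R / 2 ^ k))) / (R / 2 ^ k) ^ ((n : ℝ) - 1) := by
        simp only [hb, massRatio]
        rw [← Real.rpow_mul (by positivity), hs_def, one_div_mul_cancel hp1.ne', Real.rpow_one]
      rw [this, ← Finset.sum_mul]
      simp only [hH]
      ring
    have h := halg N (fun i => b i x) (fun i => hb0 i x)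
    rw [Finset.mul_sum] at h
    simp_rw [← hterm] at h
    refine (ENNReal.ofReal_le_ofReal h).trans ?_
    rw [ENNReal.ofReal_sum_of_nonneg fun k _ => mul_nonneg (hH0 k x) measureReal_nonneg]
    refine Finset.sum_le_sum fun k _ => ?_
    rw [ENNReal.ofReal_mul (hH0 k x), ofReal_measureReal]
  have step2 : ∫⁻ x in F, ENNReal.ofReal ((∑ i ∈ Finset.range N, b i x) ^ p) ≤
      ∫⁻ y, (∑ k ∈ Finset.range N,
        ∫⁻ x in F ∩ Metric.ball y (4 * (R / 2 ^ k)), ENNReal.ofReal (H k x)) ∂μ := by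
    rw [lintegral_finsetSum _ fun k _ =>
      measurable_setLIntegral_inter_ball volume (hHm k).ennreal_ofReal hF _]
    refine (lintegral_mono fun x => step1 x).trans ?_
    rw [lintegral_finsetSum' _ fun k _ => ?_]
    · refine Finset.sum_le_sum fun k _ => ?_
      rw [setLIntegral_mul_measure_ball _ _ (hHm k).ennreal_ofReal F]
    · refine ((hHm k).ennreal_ofReal.mul ?_).aemeasurable
      have := (measurable_measureReal_ball μ (4 * (R / 2 ^ k))).ennreal_ofReal
      convert this using 2
      exact (ofReal_measureReal).symm
  refine step2.trans ?_
  have step3 : ∀ y, ∑ k ∈ Finset.range N,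
        ∫⁻ x in F ∩ Metric.ball y (4 * (R / 2 ^ k)), ENNReal.ofReal (H k x) ≤
      ENNReal.ofReal (C₂ * v * ((1 - √2 / 2)⁻¹ * (6 * ((32 : ℝ) ^ ((n : ℝ) - p)) ^ s)) * Λ) := by
    intro y
    set α : ℕ → ℝ := fun j => massRatio μ s (n - p) (R / 2 ^ j) (8 * (R / 2 ^ j)) y with hα
    have hα0 : ∀ i, 0 ≤ α i := fun i => massRatio_nonneg _ (by positivity) _
    set h : ℕ → ℝ := fun k =>
      C₂ * v * ∑ j ∈ Finset.range (k + 1), (√2 / 2) ^ (k - j) * α j with hh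
    have hh0 : ∀ k, 0 ≤ h k := fun k => by
      have : 0 ≤ ∑ j ∈ Finset.range (k + 1), (√2 / 2) ^ (k - j) * α j :=
        Finset.sum_nonneg fun j _ => mul_nonneg (by positivity) (hα0 _)
      positivity
    set P : ℕ → Prop := fun k => (F ∩ Metric.ball y (4 * (R / 2 ^ k))).Nonempty with hP
    -- Only the scales at which `F` meets the ball about `y` contribute, and the volume of the ball
    -- gains the factor `2 ^ (j - k)` that beats the weight `√2 ^ (k - j)`.
    have hbound : ∀ k, ∫⁻ x in F ∩ Metric.ball y (4 * (R / 2 ^ k)), ENNReal.ofReal (H k x) ≤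
        ENNReal.ofReal (if P k then h k else 0) := by
      intro k
      split_ifs with hPk
      · set ρ := R / 2 ^ k with hρ
        have hρ0 : 0 < ρ := by positivity
        have hsup : ∀ x ∈ F ∩ Metric.ball y (4 * ρ), ENNReal.ofReal (H k x) ≤
            ENNReal.ofReal (h k / v / ρ ^ n) := by
          intro x hx
          refine ENNReal.ofReal_le_ofReal ?_
          have hj : ∀ j ∈ Finset.range (k + 1), √2 ^ (k - j) * b j x ≤
              (√2 / 2) ^ (k - j) * α j / ρ := by
            intro j hj
            have hjk : j ≤ k := Nat.lt_succ_iff.1 (Finset.mem_range.1 hj)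
            have hρj : ρ = R / 2 ^ j / 2 ^ (k - j) := by
              rw [div_div, ← pow_add, Nat.add_sub_cancel' hjk]
            have hle : ρ ≤ R / 2 ^ j := by
              rw [hρj]
              exact div_le_self (by positivity) (one_le_pow₀ (by norm_num))
            have h1 : b j x ≤ massRatio μ s (n - 1) (R / 2 ^ j) (8 * (R / 2 ^ j)) y := by
              refine massRatio_mono hs.le (by positivity) ?_
              have : dist x y < 4 * ρ := hx.2
              linarith
            have h2 : α j = R / 2 ^ j *
                massRatio μ s (n - 1) (R / 2 ^ j) (8 * (R / 2 ^ j)) y :=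
              (mul_massRatio hp (by positivity) y).symm
            have h3 : (√2 / 2) ^ (k - j) * α j / ρ =
                √2 ^ (k - j) * massRatio μ s (n - 1) (R / 2 ^ j) (8 * (R / 2 ^ j)) y := by
              rw [h2, hρj, div_pow]
              field_simp
            rw [h3]
            exact mul_le_mul_of_nonneg_left h1 (by positivity)
          have hsum := Finset.sum_le_sum hj
          rw [← Finset.sum_div] at hsum
          have hρn : ρ ^ n = ρ * ρ ^ ((n : ℝ) - 1) := by
            rw [Real.rpow_sub_one hρ0.ne', Real.rpow_natCast]; field_simp
          have e : h k / v / ρ ^ n = C₂ * ((∑ j ∈ Finset.range (k + 1),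
              (√2 / 2) ^ (k - j) * α j) / ρ) / ρ ^ ((n : ℝ) - 1) := by
            rw [hρn]; simp only [hh]; field_simp
          rw [e]
          simp only [hH, ← hρ]
          gcongr
        refine (setLIntegral_mono measurable_const hsup).trans ?_
        rw [setLIntegral_const]
        refine (mul_le_mul_right (measure_mono inter_subset_right) _).trans ?_
        rw [← ofReal_measureReal measure_ball_lt_top.ne, mul_comm 4 ρ,
          volumeReal_ball_mul y hρ0, ← hv, ← ENNReal.ofReal_mul (by
            have := hh0 k; positivity)]
        refine ENNReal.ofReal_le_ofReal (le_of_eq ?_)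
        field_simp
      · rw [hP, Set.not_nonempty_iff_eq_empty] at hPk
        rw [hPk]; simp
    refine (Finset.sum_le_sum fun k _ => hbound k).trans ?_
    rw [← ENNReal.ofReal_sum_of_nonneg fun k _ => by split_ifs; exacts [hh0 k, le_rfl]]
    refine ENNReal.ofReal_le_ofReal ?_
    refine sum_ite_le_of_forall (by positivity) N ?_ hh0
    rintro M hM ⟨x', hx'F, hx'⟩
    have h1 := sum_massRatio_le_of_near (μ := μ) (y := y) hs (sub_nonneg.2 hpn) hR hM
      (by rw [dist_comm]; exact hx') (hFΛ x' hx'F) hΛ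
    have h2 := sum_sum_geometric_le (q := √2 / 2) (by positivity) hq1 (M + 1) α hα0
    simp only [hh]
    rw [← Finset.mul_sum, mul_assoc (C₂ * v), mul_assoc (1 - √2 / 2)⁻¹, mul_assoc (6 : ℝ)]
    refine mul_le_mul_of_nonneg_left (h2.trans ?_) (by positivity)
    exact mul_le_mul_of_nonneg_left h1 (by positivity)
  refine (lintegral_mono (μ := μ) step3).trans ?_
  rw [lintegral_const]

/-! ### The capacitary weak-type estimate -/

/-- A smooth substitute for the dyadic Wolff sum
`∑_{i < N} (μ(B(x, ρᵢ)) / ρᵢ^{n-p})^{1/(p-1)}`, `ρᵢ = R 2⁻ⁱ`. -/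
def smoothedWolff (μ : Measure (EuclideanSpace ℝ (Fin n))) (p R : ℝ) (N : ℕ)
    (x : EuclideanSpace ℝ (Fin n)) : ℝ :=
  ∑ i ∈ Finset.range N, (((R / 2 ^ i) ^ ((n : ℝ) - p))⁻¹) ^ (1 / (p - 1)) *
    smoothedMass μ (1 / (p - 1)) (R / 2 ^ i) x

lemma contDiff_smoothedWolff (μ : Measure (EuclideanSpace ℝ (Fin n))) [IsFiniteMeasure μ]
    {p R : ℝ} (hp : 1 < p) (hR : 0 < R) (N : ℕ) :
    ContDiff ℝ ((⊤ : ℕ∞) : WithTop ℕ∞) (smoothedWolff μ p R N) := by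
  have hp1 : 0 < p - 1 := by linarith
  exact ContDiff.sum fun i _ =>
    contDiff_const.mul (contDiff_smoothedMass μ (by positivity) (by positivity))

lemma smoothedWolff_mono (μ : Measure (EuclideanSpace ℝ (Fin n))) {p R : ℝ} (hR : 0 < R)
    (x : EuclideanSpace ℝ (Fin n)) :
    Monotone fun N => smoothedWolff μ p R N x := by
  intro N N' h
  exact Finset.sum_le_sum_of_subset_of_nonneg (Finset.range_subset_range.2 h) fun i _ _ =>
    mul_nonneg (by positivity) (smoothedMass_nonneg _ (by positivity) _)

lemma le_smoothedWolff (μ : Measure (EuclideanSpace ℝ (Fin n))) [IsFiniteMeasure μ]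
    {p R : ℝ} (hp : 1 < p) (hR : 0 < R) (N : ℕ) (x : EuclideanSpace ℝ (Fin n)) :
    volume.real (Metric.ball (0 : EuclideanSpace ℝ (Fin n)) (1 / 2)) *
      ∑ i ∈ Finset.range N, massRatio μ (1 / (p - 1)) (n - p) (R / 2 ^ i) (R / 2 ^ i / 2) x ≤
      smoothedWolff μ p R N x := by
  have hp1 : 0 < p - 1 := by linarith
  rw [Finset.mul_sum]
  refine Finset.sum_le_sum fun i _ => ?_
  rw [massRatio, div_eq_mul_inv (μ.real _), Real.mul_rpow (by positivity) (by positivity)]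
  have := le_smoothedMass μ (s := 1 / (p - 1)) (ρ := R / 2 ^ i) (by positivity) (by positivity) x
  rw [mul_comm (μ.real _ ^ _), mul_left_comm]
  exact mul_le_mul_of_nonneg_left this (by positivity)

lemma measure_ball_ne_zero_of_smoothedWolff_ne_zero (μ : Measure (EuclideanSpace ℝ (Fin n)))
    [IsFiniteMeasure μ] {p R : ℝ} (hp : 1 < p) (hR : 0 < R) {N : ℕ}
    {x : EuclideanSpace ℝ (Fin n)} (h : smoothedWolff μ p R N x ≠ 0) :
    μ (Metric.ball x (2 * R)) ≠ 0 := by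
  have hp1 : 0 < p - 1 := by linarith
  obtain ⟨i, -, hi⟩ := Finset.exists_ne_zero_of_sum_ne_zero h
  intro h0
  refine hi ?_
  rw [smoothedMass_eq_zero (by positivity) (by positivity), mul_zero]
  refine measure_mono_null (Metric.ball_subset_ball ?_) h0
  have : R / 2 ^ i ≤ R := div_le_self hR.le (one_le_pow₀ (by norm_num))
  linarith

lemma exists_norm_fderiv_smoothedWolff_le (n : ℕ) {p : ℝ} (hp : 1 < p) :
    ∃ C : ℝ, 0 < C ∧ ∀ (μ : Measure (EuclideanSpace ℝ (Fin n))) [IsFiniteMeasure μ] (R : ℝ),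
      0 < R → ∀ N x, ‖fderiv ℝ (smoothedWolff μ p R N) x‖ ≤
        C * ∑ i ∈ Finset.range N,
          massRatio μ (1 / (p - 1)) (n - 1) (R / 2 ^ i) (4 * (R / 2 ^ i)) x := by
  obtain ⟨C, hC, hCb⟩ := exists_norm_fderiv_smoothedMass_le n
  have hp1 : 0 < p - 1 := by linarith
  refine ⟨C, hC, fun μ _ R hR N x => ?_⟩
  have hd : ∀ i, DifferentiableAt ℝ (smoothedMass μ (1 / (p - 1)) (R / 2 ^ i)) x := fun i =>
    (contDiff_smoothedMass μ (by positivity) (by positivity)).differentiable (by simp) x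
  unfold smoothedWolff
  rw [fderiv_fun_sum fun i _ => (hd i).const_mul _, Finset.mul_sum]
  refine (norm_sum_le _ _).trans (Finset.sum_le_sum fun i _ => ?_)
  have hρ : 0 < R / 2 ^ i := by positivity
  have h := hCb μ (1 / (p - 1)) (R / 2 ^ i) (by positivity) hρ x
  rw [fderiv_const_mul (hd i), norm_smul, Real.norm_of_nonneg (by positivity)]
  refine (mul_le_mul_of_nonneg_left h (by positivity)).trans (le_of_eq ?_)
  have e := mul_massRatio (μ := μ) (r := 4 * (R / 2 ^ i)) hp hρ x
  rw [← eq_inv_mul_iff_mul_eq₀ hρ.ne'] at e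
  rw [e, massRatio, div_eq_mul_inv (μ.real _), Real.mul_rpow (by positivity) (by positivity)]
  ring

lemma exists_abs_deriv_smoothTransition_le :
    ∃ B : ℝ, 0 < B ∧ (∀ t, |deriv Real.smoothTransition t| ≤ B) ∧
      ∀ t, 1 ≤ t → deriv Real.smoothTransition t = 0 := by
  have h1 : ∀ t, 1 ≤ t → deriv Real.smoothTransition t = 0 := fun t ht =>
    IsLocalMax.deriv_eq_zero (Eventually.of_forall fun y => by
      rw [Real.smoothTransition.one_of_one_le ht]; exact Real.smoothTransition.le_one y)
  have h0 : ∀ t, t ≤ 0 → deriv Real.smoothTransition t = 0 := fun t ht =>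
    IsLocalMin.deriv_eq_zero (Eventually.of_forall fun y => by
      rw [Real.smoothTransition.zero_of_nonpos ht]; exact Real.smoothTransition.nonneg y)
  obtain ⟨B, hB⟩ := (isCompact_Icc (a := (0 : ℝ)) (b := 1)).exists_bound_of_continuousOn
    ((Real.smoothTransition.contDiff (n := 1)).continuous_deriv le_rfl).continuousOn
  refine ⟨|B| + 1, by positivity, fun t => ?_, h1⟩
  rcases le_or_gt 1 t with ht | ht
  · rw [h1 t ht, abs_zero]; positivity
  rcases le_or_gt t 0 with ht' | ht'
  · rw [h0 t ht', abs_zero]; positivity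
  · have := hB t ⟨ht'.le, ht.le⟩
    rw [Real.norm_eq_abs] at this
    linarith [le_abs_self B]

lemma norm_gradient (u : EuclideanSpace ℝ (Fin n) → ℝ) (x : EuclideanSpace ℝ (Fin n)) :
    ‖gradient u x‖ = ‖fderiv ℝ u x‖ := by
  rw [gradient, LinearIsometryEquiv.norm_map]

/-- **Capacitary weak-type estimate for the dyadic Wolff sum.** Off an open set `G`, the sum is at
most a multiple of `Λ`; every compact subset of `G` has capacity at most a multiple of
`Λ^{1-p} μ(ℝⁿ)`. The test function is a smooth truncation of `smoothedWolff`. -/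
lemma exists_isOpen_capCompact_le (n : ℕ) {p : ℝ} (hp : 1 < p) (hpn : p ≤ n) :
    ∃ C : ℝ, 0 < C ∧ ∀ (μ : Measure (EuclideanSpace ℝ (Fin n))) [IsFiniteMeasure μ] (R Λ : ℝ)
      (A U : Set (EuclideanSpace ℝ (Fin n))), 0 < R → 0 < Λ → Bornology.IsBounded A → μ Aᶜ = 0 →
      Metric.cthickening (2 * R) A ⊆ U →
      (μ.real univ / R ^ (n - p)) ^ (1 / (p - 1)) ≤ Λ →
      ∃ G : Set (EuclideanSpace ℝ (Fin n)), IsOpen G ∧ G ⊆ U ∧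
        (∀ K, IsCompact K → K ⊆ G → capCompact p K U ≤ ENNReal.ofReal (C * Λ ^ (1 - p)) * μ univ) ∧
        ∀ x ∉ G, ∀ N, ∑ i ∈ Finset.range N,
          massRatio μ (1 / (p - 1)) (n - p) (R / 2 ^ i) (R / 2 ^ i / 2) x ≤ C * Λ := by
  obtain ⟨C₁, hC₁, hgrad⟩ := exists_norm_fderiv_smoothedWolff_le n hp
  obtain ⟨C₂, hC₂, hener⟩ := exists_setLIntegral_rpow_sum_massRatio_le n hp hpn
  obtain ⟨B, hB, hB1, hB2⟩ := exists_abs_deriv_smoothTransition_le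
  set v := volume.real (Metric.ball (0 : EuclideanSpace ℝ (Fin n)) (1 / 2)) with hv
  have hv0 : 0 < v :=
    ENNReal.toReal_pos (Metric.measure_ball_pos _ _ (by norm_num)).ne' measure_ball_lt_top.ne
  have hp0 : 0 < p := by linarith
  refine ⟨(B * C₁) ^ p * (C₂ * (v⁻¹ + 1)) + v⁻¹, by positivity, ?_⟩
  intro μ _ R Λ A U hR hΛ hA hμA hAU hmass
  have hsub : ∀ N x, smoothedWolff μ p R N x ≠ 0 → x ∈ Metric.cthickening (2 * R) A := by
    intro N x hx
    have h1 := measure_ball_ne_zero_of_smoothedWolff_ne_zero μ hp hR hx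
    have h2 : (Metric.ball x (2 * R) ∩ A).Nonempty := by
      by_contra h
      rw [Set.not_nonempty_iff_eq_empty, ← Set.disjoint_iff_inter_eq_empty,
        ← Set.subset_compl_iff_disjoint_right] at h
      exact h1 (measure_mono_null h hμA)
    obtain ⟨z, hz1, hz2⟩ := h2
    exact Metric.thickening_subset_cthickening _ _
      (Metric.mem_thickening_iff.2 ⟨z, hz2, Metric.mem_ball'.1 hz1⟩)
  refine ⟨⋃ N, {x | Λ < smoothedWolff μ p R N x}, isOpen_iUnion fun N =>
    isOpen_lt continuous_const (contDiff_smoothedWolff μ hp hR N).continuous, ?_, ?_, ?_⟩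
  · refine Set.iUnion_subset fun N x hx => hAU (hsub N x ?_)
    exact (hΛ.trans hx).ne'
  · intro K hK hKG
    obtain ⟨N, hN⟩ := hK.elim_directed_cover _ (fun N =>
      isOpen_lt continuous_const (contDiff_smoothedWolff μ hp hR N).continuous) hKG
      (directed_of_isDirected_le fun N N' h x hx =>
        lt_of_lt_of_le hx (smoothedWolff_mono μ hR x h))
    set V := smoothedWolff μ p R N with hV
    have hVs : ContDiff ℝ ((⊤ : ℕ∞) : WithTop ℕ∞) V := contDiff_smoothedWolff μ hp hR N
    set u : EuclideanSpace ℝ (Fin n) → ℝ := fun x => Real.smoothTransition (V x / Λ) with hu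
    have hsupp : Function.support u ⊆ Metric.cthickening (2 * R) A := by
      intro x hx
      refine hsub N x fun h => hx ?_
      simp only [hu, hV, h, zero_div, Real.smoothTransition.zero]
    have hcpt : IsCompact (Metric.cthickening (2 * R) A) :=
      Metric.isCompact_of_isClosed_isBounded Metric.isClosed_cthickening hA.cthickening
    have hadm : ContDiff ℝ ((⊤ : ℕ∞) : WithTop ℕ∞) u ∧ HasCompactSupport u ∧ tsupport u ⊆ U ∧
        ∀ x ∈ K, 1 ≤ u x := by
      refine ⟨Real.smoothTransition.contDiff.comp (hVs.div_const _),
        HasCompactSupport.of_support_subset_isCompact hcpt hsupp,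
        (closure_minimal hsupp Metric.isClosed_cthickening).trans hAU, fun x hx => ?_⟩
      rw [hu]
      simp only
      rw [Real.smoothTransition.one_of_one_le]
      rw [one_le_div hΛ]
      exact (hN hx).le
    refine (iInf₂_le u hadm).trans ?_
    set F : Set (EuclideanSpace ℝ (Fin n)) := {x | V x ≤ Λ} with hF
    have hFm : MeasurableSet F := (isClosed_le hVs.continuous continuous_const).measurableSet
    set S : EuclideanSpace ℝ (Fin n) → ℝ := fun x => ∑ i ∈ Finset.range N,
        massRatio μ (1 / (p - 1)) (n - 1) (R / 2 ^ i) (4 * (R / 2 ^ i)) x with hS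
    have hS0 : ∀ x, 0 ≤ S x := fun x =>
      Finset.sum_nonneg fun i _ => massRatio_nonneg _ (by positivity) _
    have hgu : ∀ x, ENNReal.ofReal (‖gradient u x‖ ^ p) ≤
        F.indicator (fun x => ENNReal.ofReal ((B * C₁ / Λ) ^ p) * ENNReal.ofReal (S x ^ p)) x := by
      intro x
      have hVd : HasFDerivAt V (fderiv ℝ V x) x :=
        (hVs.differentiable (by simp) x).hasFDerivAt
      have hder : HasFDerivAt u (deriv Real.smoothTransition (V x / Λ) • (Λ⁻¹ • fderiv ℝ V x)) x :=
        ((((Real.smoothTransition.contDiff (n := 1)).differentiable (by simp)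
          (V x / Λ)).hasDerivAt).comp_hasFDerivAt (f := fun y => V y / Λ) x (by
            simpa only [div_eq_inv_mul] using hVd.const_mul Λ⁻¹))
      rw [norm_gradient, hder.fderiv]
      by_cases hx : x ∈ F
      · rw [Set.indicator_of_mem hx, ← ENNReal.ofReal_mul (by positivity),
          ← Real.mul_rpow (by positivity) (hS0 x)]
        refine ENNReal.ofReal_le_ofReal (Real.rpow_le_rpow (norm_nonneg _) ?_ hp0.le)
        rw [norm_smul, norm_smul, Real.norm_eq_abs, Real.norm_of_nonneg (by positivity)]
        calc _ ≤ B * (Λ⁻¹ * (C₁ * S x)) :=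
              mul_le_mul (hB1 _) (mul_le_mul_of_nonneg_left (hgrad μ R hR N x) (by positivity))
                (by positivity) hB.le
          _ = _ := by field_simp
      · have : 1 ≤ V x / Λ := by
          rw [one_le_div hΛ]
          exact (not_le.1 hx).le
        rw [hB2 _ this, zero_smul, norm_zero, Real.zero_rpow hp0.ne', ENNReal.ofReal_zero]
        exact zero_le
    have hE := hener μ R (Λ * (v⁻¹ + 1)) N F hR hFm (fun x hx => by
      have h1 := le_smoothedWolff μ hp hR N x
      rw [← hv] at h1
      have h2 := h1.trans hx
      rw [mul_comm, ← le_div_iff₀ hv0, div_eq_mul_inv Λ] at h2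
      refine h2.trans ?_
      rw [mul_add, mul_one]
      linarith) (hmass.trans (by
        have : 0 < v⁻¹ := by positivity
        nlinarith))
    calc ∫⁻ x in U, ENNReal.ofReal (‖gradient u x‖ ^ p)
        ≤ ∫⁻ x, ENNReal.ofReal (‖gradient u x‖ ^ p) := setLIntegral_le_lintegral _ _
      _ ≤ ∫⁻ x, F.indicator
          (fun x => ENNReal.ofReal ((B * C₁ / Λ) ^ p) * ENNReal.ofReal (S x ^ p)) x :=
          lintegral_mono hgu
      _ = ENNReal.ofReal ((B * C₁ / Λ) ^ p) * ∫⁻ x in F, ENNReal.ofReal (S x ^ p) := by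
          rw [lintegral_indicator hFm, lintegral_const_mul' _ _ ENNReal.ofReal_ne_top]
      _ ≤ ENNReal.ofReal ((B * C₁ / Λ) ^ p) *
          (ENNReal.ofReal (C₂ * (Λ * (v⁻¹ + 1))) * μ univ) := by gcongr
      _ ≤ _ := by
          rw [← mul_assoc, ← ENNReal.ofReal_mul (by positivity)]
          refine mul_le_mul_left (ENNReal.ofReal_le_ofReal ?_) _
          rw [Real.div_rpow (by positivity) hΛ.le, Real.rpow_sub hΛ, Real.rpow_one]
          have : 0 ≤ v⁻¹ * (Λ / Λ ^ p) := by positivity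
          calc (B * C₁) ^ p / Λ ^ p * (C₂ * (Λ * (v⁻¹ + 1)))
              = (B * C₁) ^ p * (C₂ * (v⁻¹ + 1)) * (Λ / Λ ^ p) := by ring
            _ ≤ _ := by linarith
  · intro x hx N
    have hx' : smoothedWolff μ p R N x ≤ Λ := by
      by_contra h
      exact hx (Set.mem_iUnion.2 ⟨N, not_le.1 h⟩)
    have h2 := (le_smoothedWolff μ hp hR N x).trans hx'
    rw [← hv, mul_comm, ← le_div_iff₀ hv0, div_eq_inv_mul Λ] at h2
    refine h2.trans ?_
    gcongr
    have : 0 < (B * C₁) ^ p * (C₂ * (v⁻¹ + 1)) := by positivity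
    linarith

/-! ### Capacity of spheres -/

lemma one_le_lintegral_of_line {u : EuclideanSpace ℝ (Fin n) → ℝ}
    (hu : ContDiff ℝ ((⊤ : ℕ∞) : WithTop ℕ∞) u) {x e : EuclideanSpace ℝ (Fin n)} (he : ‖e‖ = 1)
    {a b : ℝ} (ha : 0 ≤ a) (hab : a ≤ b) (h1 : 1 ≤ u (x + a • e)) (h0 : u (x + b • e) = 0) :
    1 ≤ ∫⁻ t in Ioc 0 b, ENNReal.ofReal ‖gradient u (x + t • e)‖ := by
  set f' : ℝ → ℝ := fun t => fderiv ℝ u (x + t • e) e with hf'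
  have hder : ∀ t, HasDerivAt (fun t => u (x + t • e)) (f' t) t := by
    intro t
    have hline : HasDerivAt (fun t : ℝ => x + t • e) e t := by
      simpa using ((hasDerivAt_id t).smul_const e).const_add x
    exact ((hu.differentiable (by simp) _).hasFDerivAt).comp_hasDerivAt t hline
  have hcont : Continuous f' :=
    ((hu.continuous_fderiv (by simp)).comp (by fun_prop)).clm_apply continuous_const
  have hFTC := intervalIntegral.integral_eq_sub_of_hasDerivAt (fun t _ => hder t)
    (hcont.intervalIntegrable a b)
  have hle : (1 : ℝ) ≤ ‖∫ t in a..b, f' t‖ := by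
    rw [hFTC, h0, zero_sub, norm_neg, Real.norm_eq_abs]
    exact h1.trans (le_abs_self _)
  calc (1 : ℝ≥0∞) = ENNReal.ofReal 1 := by simp
    _ ≤ ENNReal.ofReal ‖∫ t in a..b, f' t‖ := ENNReal.ofReal_le_ofReal hle
    _ ≤ ∫⁻ t in Ioc a b, ENNReal.ofReal ‖f' t‖ := by
        rw [intervalIntegral.integral_of_le hab, ofReal_norm]
        refine (enorm_integral_le_lintegral_enorm _).trans (le_of_eq ?_)
        simp_rw [ofReal_norm]
    _ ≤ ∫⁻ t in Ioc a b, ENNReal.ofReal ‖gradient u (x + t • e)‖ := by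
        refine lintegral_mono fun t => ENNReal.ofReal_le_ofReal ?_
        rw [norm_gradient]
        simpa [he] using (fderiv ℝ u (x + t • e)).le_opNorm e
    _ ≤ _ := lintegral_mono_set (Ioc_subset_Ioc_left ha)

lemma lintegral_Ioc_le_rpow {p : ℝ} (hp : 1 < p) {b : ℝ} {g : ℝ → ℝ≥0∞}
    (hg : Measurable g) :
    (∫⁻ t in Ioc 0 b, g t) ^ p ≤
      ENNReal.ofReal b ^ (p - 1) * ∫⁻ t in Ioc 0 b, g t ^ p := by
  have hpq := Real.HolderConjugate.conjExponent hp
  have hp0 : 0 < p := by linarith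
  have h := ENNReal.lintegral_mul_le_Lp_mul_Lq (volume.restrict (Ioc 0 b)) hpq hg.aemeasurable
    (g := fun _ => 1) aemeasurable_const
  simp only [Pi.mul_apply, mul_one, ENNReal.one_rpow, lintegral_const, one_mul,
    Measure.restrict_apply MeasurableSet.univ, univ_inter, Real.volume_Ioc, sub_zero] at h
  have h2 := ENNReal.rpow_le_rpow h hp0.le
  refine h2.trans (le_of_eq ?_)
  rw [ENNReal.mul_rpow_of_nonneg _ _ hp0.le, ← ENNReal.rpow_mul, one_div_mul_cancel hp0.ne',
    ENNReal.rpow_one, ← ENNReal.rpow_mul, mul_comm]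
  congr 2
  rw [Real.conjExponent]
  have : p - 1 ≠ 0 := by linarith
  field_simp

/-- Every line in a fixed direction through the ball of radius `r/2` meets the sphere of radius `r`
and leaves the ball of radius `2r`, so a test function drops from `1` to `0` along it. Averaging
over these lines bounds its energy from below. -/
lemma exists_le_capCompact_sphere {p : ℝ} (hn : 0 < n) (hp : 1 < p) :
    ∃ c : ℝ, 0 < c ∧ ∀ (x₀ : EuclideanSpace ℝ (Fin n)) (r : ℝ), 0 < r →
      ENNReal.ofReal (c * r ^ (n - p)) ≤
        capCompact p (Metric.sphere x₀ r) (Metric.ball x₀ (2 * r)) := by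
  set v := volume.real (Metric.ball (0 : EuclideanSpace ℝ (Fin n)) (1 / 2)) with hv
  have hv0 : 0 < v :=
    ENNReal.toReal_pos (Metric.measure_ball_pos _ _ (by norm_num)).ne' measure_ball_lt_top.ne
  have hp0 : 0 < p := by linarith
  refine ⟨v / 4 ^ p, by positivity, fun x₀ r hr => le_iInf₂ fun u hu => ?_⟩
  obtain ⟨hsmooth, -, hsupp, hone⟩ := hu
  set e : EuclideanSpace ℝ (Fin n) := EuclideanSpace.single ⟨0, hn⟩ 1 with he
  have he1 : ‖e‖ = 1 := by simp [he]
  set g : EuclideanSpace ℝ (Fin n) → ℝ≥0∞ := fun x => ENNReal.ofReal (‖gradient u x‖ ^ p) with hg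
  have hgm : Measurable g := by
    simp only [hg, norm_gradient]
    exact (((hsmooth.continuous_fderiv (by simp)).norm.measurable).pow_const p).ennreal_ofReal
  have hball : ∫⁻ x in Metric.ball x₀ (2 * r), g x = ∫⁻ x, g x := by
    rw [← lintegral_indicator Metric.isOpen_ball.measurableSet]
    congr 1
    ext x
    by_cases hx : x ∈ Metric.ball x₀ (2 * r)
    · rw [Set.indicator_of_mem hx]
    · rw [Set.indicator_of_notMem hx]
      have : fderiv ℝ u x = 0 := by
        by_contra h
        exact hx (hsupp (support_fderiv_subset ℝ h))
      simp only [hg, norm_gradient, this, norm_zero, Real.zero_rpow hp0.ne', ENNReal.ofReal_zero]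
  rw [hball]
  have hx : ∀ x ∈ Metric.ball x₀ (r / 2),
      1 ≤ ENNReal.ofReal (4 * r) ^ (p - 1) * ∫⁻ t in Ioc 0 (4 * r), g (x + t • e) := by
    intro x hx
    have hx : ‖x - x₀‖ < r / 2 := by rw [← dist_eq_norm]; exact hx
    have hfar : 4 * r - r / 2 < ‖x + (4 * r) • e - x₀‖ := by
      have h1 : ‖(4 * r) • e‖ = 4 * r := by
        rw [norm_smul, he1, mul_one, Real.norm_of_nonneg (by positivity)]
      have h2 : ‖(4 * r) • e‖ ≤ ‖x + (4 * r) • e - x₀‖ + ‖x - x₀‖ := by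
        have : (4 * r) • e = (x + (4 * r) • e - x₀) - (x - x₀) := by abel
        calc ‖(4 * r) • e‖ = ‖(x + (4 * r) • e - x₀) - (x - x₀)‖ := by rw [← this]
          _ ≤ _ := norm_sub_le _ _
      linarith
    obtain ⟨a, ⟨ha0, ha1⟩, ha⟩ : r ∈ (fun t : ℝ => ‖x + t • e - x₀‖) '' Icc 0 (4 * r) := by
      refine intermediate_value_Icc (by positivity) (by fun_prop) ⟨?_, ?_⟩
      · simp only [zero_smul, add_zero]; linarith
      · linarith
    have h0 : u (x + (4 * r) • e) = 0 := by
      by_contra h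
      have := hsupp (subset_tsupport u h)
      rw [Metric.mem_ball, dist_eq_norm] at this
      linarith
    have hline := one_le_lintegral_of_line hsmooth he1 ha0 ha1
      (hone _ (by rw [mem_sphere_iff_norm]; exact ha)) h0
    have hm : Measurable fun t : ℝ => ENNReal.ofReal ‖gradient u (x + t • e)‖ := by
      simp only [norm_gradient]
      have : Continuous fun t : ℝ => ‖fderiv ℝ u (x + t • e)‖ :=
        ((hsmooth.continuous_fderiv (by simp)).comp (by fun_prop)).norm
      exact this.measurable.ennreal_ofReal
    have h3 := (ENNReal.one_rpow p ▸ ENNReal.rpow_le_rpow hline hp0.le).trans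
      (lintegral_Ioc_le_rpow hp hm)
    refine h3.trans (le_of_eq ?_)
    congr 2
    ext t
    rw [hg, ENNReal.ofReal_rpow_of_nonneg (norm_nonneg _) hp0.le]
  have hmeas2 : Measurable (Function.uncurry fun (x : EuclideanSpace ℝ (Fin n)) (t : ℝ) =>
      g (x + t • e)) := hgm.comp (by fun_prop)
  have hint : volume (Metric.ball x₀ (r / 2)) ≤
      ENNReal.ofReal (4 * r) ^ p * ∫⁻ x, g x := by
    calc volume (Metric.ball x₀ (r / 2)) = ∫⁻ x in Metric.ball x₀ (r / 2), 1 := by simp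
      _ ≤ ∫⁻ x in Metric.ball x₀ (r / 2),
          ENNReal.ofReal (4 * r) ^ (p - 1) * ∫⁻ t in Ioc 0 (4 * r), g (x + t • e) :=
          setLIntegral_mono' Metric.isOpen_ball.measurableSet hx
      _ ≤ ∫⁻ x, ENNReal.ofReal (4 * r) ^ (p - 1) * ∫⁻ t in Ioc 0 (4 * r), g (x + t • e) :=
          setLIntegral_le_lintegral _ _
      _ = ENNReal.ofReal (4 * r) ^ (p - 1) *
          ∫⁻ t in Ioc 0 (4 * r), ∫⁻ x, g (x + t • e) := by
          rw [lintegral_const_mul' _ _ (ENNReal.rpow_ne_top_of_nonneg (by linarith)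
            ENNReal.ofReal_ne_top), lintegral_lintegral_swap hmeas2.aemeasurable]
      _ = ENNReal.ofReal (4 * r) ^ (p - 1) * (ENNReal.ofReal (4 * r) * ∫⁻ x, g x) := by
          simp_rw [lintegral_add_right_eq_self]
          rw [setLIntegral_const, Real.volume_Ioc, sub_zero, mul_comm (∫⁻ x, g x)]
      _ = _ := by
          have h4 : ENNReal.ofReal (4 * r) ≠ 0 := by
            rw [Ne, ENNReal.ofReal_eq_zero, not_le]; positivity
          rw [← mul_assoc, ENNReal.rpow_sub _ _ h4 ENNReal.ofReal_ne_top, ENNReal.rpow_one,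
            ENNReal.div_mul_cancel h4 ENNReal.ofReal_ne_top]
  rw [← ofReal_measureReal measure_ball_lt_top.ne, div_eq_mul_one_div, volumeReal_ball_mul x₀ hr,
    ← hv, ENNReal.ofReal_rpow_of_nonneg (by positivity) hp0.le] at hint
  replace hint := ENNReal.div_le_of_le_mul' hint
  rw [← ENNReal.ofReal_div_of_pos (by positivity)] at hint
  refine le_trans (ENNReal.ofReal_le_ofReal (le_of_eq ?_)) hint
  rw [Real.mul_rpow (by norm_num) hr.le, Real.rpow_sub hr, Real.rpow_natCast]
  field_simp

lemma capCompact_le_cap {p : ℝ} {K U : Set (EuclideanSpace ℝ (Fin n))} (hK : IsCompact K) :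
    capCompact p K U ≤ cap p K U :=
  le_iInf₂ fun _ hG => le_iSup₂_of_le K ⟨hK, hG.2.1⟩ le_rfl

lemma cap_le_of_isOpen {p : ℝ} {E G U : Set (EuclideanSpace ℝ (Fin n))} {c : ℝ≥0∞}
    (hG : IsOpen G) (hEG : E ⊆ G) (hGU : G ⊆ U)
    (h : ∀ K, IsCompact K → K ⊆ G → capCompact p K U ≤ c) : cap p E U ≤ c :=
  (iInf₂_le G ⟨hG, hEG, hGU⟩).trans (iSup₂_le fun K hK => h K hK.1 hK.2)

/-! ### Splitting the Wolff potential by radii -/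

/-- The contribution of the radii `t ∈ T` to the Wolff potential. The exponents are
`s = 1/(p-1)` and `α = (n-p)/(p-1)`. -/
def wolffPart (μ : Measure (EuclideanSpace ℝ (Fin n))) (s α : ℝ) (T : Set ℝ)
    (x : EuclideanSpace ℝ (Fin n)) : ℝ≥0∞ :=
  ∫⁻ t in T, μ (Metric.ball x t) ^ s * ENNReal.ofReal (t ^ (-(α + 1)))

lemma wolff_eq_wolffPart (μ : Measure (EuclideanSpace ℝ (Fin n))) {p : ℝ} (hp : 1 < p)
    (x : EuclideanSpace ℝ (Fin n)) (r : ℝ) :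
    wolff p μ x r = wolffPart μ (1 / (p - 1)) (((n : ℝ) - p) / (p - 1)) (Ioo 0 r) x := by
  have hp1 : 0 < p - 1 := by linarith
  refine setLIntegral_congr_fun measurableSet_Ioo fun t ht => ?_
  have ht0 : 0 < t := ht.1
  have e : t ^ (-(((n : ℝ) - p) / (p - 1) + 1)) =
      ((t ^ ((n : ℝ) - p)) ^ (1 / (p - 1)))⁻¹ * t⁻¹ := by
    rw [← Real.rpow_mul ht0.le, mul_one_div, neg_add, Real.rpow_add ht0, Real.rpow_neg ht0.le,
      Real.rpow_neg_one]
  rw [e, ENNReal.ofReal_mul (by positivity), ENNReal.ofReal_inv_of_pos (by positivity),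
    ENNReal.ofReal_inv_of_pos ht0, ENNReal.div_rpow_of_nonneg _ _ (by positivity),
    ENNReal.ofReal_rpow_of_nonneg (by positivity) (by positivity), div_eq_mul_inv, div_eq_mul_inv,
    mul_assoc]

/-- If the dyadic Wolff sums of `μ` restricted to a neighbourhood of `x` are at most `B`, then the
small radii contribute at most a multiple of `B` to the Wolff potential at `x`. -/
lemma wolffPart_Ioo_le_of_sum_le (μ : Measure (EuclideanSpace ℝ (Fin n))) [IsFiniteMeasure μ]
    {s a R B : ℝ} (hs : 0 ≤ s) (ha : 0 ≤ a) (hR : 0 < R) {x : EuclideanSpace ℝ (Fin n)}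
    {A : Set (EuclideanSpace ℝ (Fin n))} (hA : Metric.ball x (R / 2) ⊆ A)
    (h : ∀ N, ∑ i ∈ Finset.range N,
      massRatio (μ.restrict A) s a (R / 2 ^ i) (R / 2 ^ i / 2) x ≤ B) :
    wolffPart μ s (a * s) (Ioo 0 (R / 2)) x ≤ ENNReal.ofReal ((4 : ℝ) ^ (a * s) * B) := by
  have hcover : Ioo 0 (R / 2) ⊆ ⋃ i : ℕ, Ico (R / 2 ^ i / 4) (R / 2 ^ i / 2) := by
    intro t ht
    have hex : ∃ i : ℕ, R / 2 ^ i / 4 ≤ t := by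
      obtain ⟨i, hi⟩ := exists_pow_lt_of_lt_one (div_pos ht.1 hR) (by norm_num : (1 / 2 : ℝ) < 1)
      refine ⟨i, ?_⟩
      rw [lt_div_iff₀ hR, one_div, inv_pow] at hi
      have h0 : 0 < R / 2 ^ i := by positivity
      have : R / 2 ^ i < t := by rw [div_eq_inv_mul]; exact hi
      linarith
    classical
    refine Set.mem_iUnion.2 ⟨Nat.find hex, Nat.find_spec hex, ?_⟩
    rcases hk : Nat.find hex with _ | k
    · simpa using ht.2
    · have := Nat.find_min hex (m := k) (by omega)
      rw [not_le] at this
      refine this.trans_le (le_of_eq ?_)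
      rw [pow_succ]; field_simp; norm_num
  have hpiece : ∀ i : ℕ, wolffPart μ s (a * s) (Ico (R / 2 ^ i / 4) (R / 2 ^ i / 2)) x ≤
      ENNReal.ofReal ((4 : ℝ) ^ (a * s) *
        massRatio (μ.restrict A) s a (R / 2 ^ i) (R / 2 ^ i / 2) x) := by
    intro i
    set ρ := R / 2 ^ i with hρ
    have hρ0 : 0 < ρ := by positivity
    have hρR : ρ ≤ R := div_le_self hR.le (one_le_pow₀ (by norm_num))
    have hm : μ (Metric.ball x (ρ / 2)) = ENNReal.ofReal
        ((μ.restrict A).real (Metric.ball x (ρ / 2))) := by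
      rw [ofReal_measureReal, Measure.restrict_apply Metric.isOpen_ball.measurableSet,
        Set.inter_eq_left.2]
      exact (Metric.ball_subset_ball (by linarith)).trans hA
    set m := (μ.restrict A).real (Metric.ball x (ρ / 2)) with hmdef
    have hm0 : 0 ≤ m := measureReal_nonneg
    have hint : ∀ t ∈ Ico (ρ / 4) (ρ / 2),
        μ (Metric.ball x t) ^ s * ENNReal.ofReal (t ^ (-(a * s + 1))) ≤
          ENNReal.ofReal (m ^ s * (ρ / 4) ^ (-(a * s + 1))) := by
      intro t ht
      rw [ENNReal.ofReal_mul (by positivity), ← ENNReal.ofReal_rpow_of_nonneg hm0 hs, ← hm]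
      refine mul_le_mul' (ENNReal.rpow_le_rpow (measure_mono
        (Metric.ball_subset_ball ht.2.le)) hs) (ENNReal.ofReal_le_ofReal ?_)
      have : 0 ≤ a * s := mul_nonneg ha hs
      exact Real.rpow_le_rpow_of_nonpos (by positivity) ht.1 (by linarith)
    refine (setLIntegral_mono measurable_const hint).trans ?_
    rw [setLIntegral_const, Real.volume_Ico, ← ENNReal.ofReal_mul (by positivity)]
    refine ENNReal.ofReal_le_ofReal (le_of_eq ?_)
    have h4 : 0 < ρ / 4 := by positivity
    rw [massRatio, ← hmdef, Real.div_rpow hm0 (by positivity), ← Real.rpow_mul hρ0.le,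
      show -(a * s + 1) = -(a * s) - 1 by ring, Real.rpow_sub_one h4.ne', Real.rpow_neg h4.le,
      Real.div_rpow hρ0.le (by norm_num)]
    field_simp
    ring
  calc wolffPart μ s (a * s) (Ioo 0 (R / 2)) x
      ≤ wolffPart μ s (a * s) (⋃ i : ℕ, Ico (R / 2 ^ i / 4) (R / 2 ^ i / 2)) x :=
        lintegral_mono_set hcover
    _ ≤ ∑' i : ℕ, wolffPart μ s (a * s) (Ico (R / 2 ^ i / 4) (R / 2 ^ i / 2)) x :=
        lintegral_iUnion_le _ _
    _ ≤ ∑' i : ℕ, ENNReal.ofReal ((4 : ℝ) ^ (a * s) *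
          massRatio (μ.restrict A) s a (R / 2 ^ i) (R / 2 ^ i / 2) x) :=
        ENNReal.tsum_le_tsum hpiece
    _ ≤ _ := by
        refine ENNReal.tsum_le_of_sum_range_le fun N => ?_
        rw [← ENNReal.ofReal_sum_of_nonneg fun i _ =>
          mul_nonneg (by positivity) (massRatio_nonneg _ (by positivity) _), ← Finset.mul_sum]
        exact ENNReal.ofReal_le_ofReal (mul_le_mul_of_nonneg_left (h N) (by positivity))

lemma tendsto_measure_closedBall (μ : Measure (EuclideanSpace ℝ (Fin n))) [IsFiniteMeasure μ]
    (x₀ : EuclideanSpace ℝ (Fin n)) :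
    Tendsto (fun r => μ (Metric.closedBall x₀ r)) (𝓝[>] 0) (𝓝 (μ {x₀})) := by
  have h := tendsto_measure_biInter_gt (μ := μ) (s := fun r => Metric.closedBall x₀ r)
    (a := (0 : ℝ)) (fun r _ => Metric.isClosed_closedBall.measurableSet.nullMeasurableSet)
    (fun i j _ hij => Metric.closedBall_subset_closedBall hij) ⟨1, one_pos, measure_ne_top _ _⟩
  suffices e : ⋂ r > (0 : ℝ), Metric.closedBall x₀ r = {x₀} by rwa [e] at h
  ext y
  simp only [mem_singleton_iff, mem_iInter, Metric.mem_closedBall]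
  constructor
  · intro h
    exact dist_le_zero.1 (le_of_forall_gt_imp_ge_of_dense fun r hr => h r hr)
  · rintro rfl r hr
    rw [dist_self]; exact le_of_lt hr

lemma tendsto_measure_closedBall_diff (μ : Measure (EuclideanSpace ℝ (Fin n))) [IsFiniteMeasure μ]
    (x₀ : EuclideanSpace ℝ (Fin n)) :
    Tendsto (fun r => μ (Metric.closedBall x₀ r \ {x₀})) (𝓝[>] 0) (𝓝 0) := by
  have h := tendsto_measure_closedBall (μ.restrict {x₀}ᶜ) x₀
  have e : ∀ S : Set (EuclideanSpace ℝ (Fin n)), MeasurableSet S →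
      μ.restrict {x₀}ᶜ S = μ (S \ {x₀}) := fun S hS => by
    rw [Measure.restrict_apply hS, Set.sdiff_eq]
  rw [e _ (measurableSet_singleton _), Set.sdiff_self, measure_empty] at h
  refine h.congr fun r => e _ Metric.isClosed_closedBall.measurableSet

/-- The normalized contribution of the radii `t > |x - x₀|`. For `t` below a fixed `η` the ball
`B(x, t)` contains `x₀` and lies in `B(x₀, 2η)`; the radii above `η` are negligible, because the
normalization `Φ` tends to `0`. -/
lemma tendsto_wolffPart_outer (μ : Measure (EuclideanSpace ℝ (Fin n))) [IsFiniteMeasure μ]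
    (x₀ : EuclideanSpace ℝ (Fin n)) {s α r₀ : ℝ} (hs : 0 < s) {Φ : ℝ → ℝ≥0∞}
    {L : ℝ≥0∞} (hL : L ≠ ⊤)
    (h1 : Tendsto (fun d => Φ d * ∫⁻ t in Ioo d r₀, ENNReal.ofReal (t ^ (-(α + 1)))) (𝓝[>] 0)
      (𝓝 L))
    (h2 : Tendsto Φ (𝓝[>] 0) (𝓝 0)) :
    Tendsto (fun x => Φ ‖x - x₀‖ * wolffPart μ s α (Ioo ‖x - x₀‖ r₀) x) (𝓝[≠] x₀)
      (𝓝 (L * μ {x₀} ^ s)) := by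
  have hnorm : Tendsto (fun x : EuclideanSpace ℝ (Fin n) => ‖x - x₀‖) (𝓝[≠] x₀) (𝓝[>] 0) :=
    tendsto_norm_sub_self_nhdsNE x₀
  have hm : ∀ S : Set (EuclideanSpace ℝ (Fin n)), μ S ^ s ≠ ⊤ := fun S =>
    ENNReal.rpow_ne_top_of_nonneg hs.le (measure_ne_top _ _)
  have h1x := h1.comp hnorm
  have h2x := h2.comp hnorm
  have hmeas : Measurable fun t : ℝ => ENNReal.ofReal (t ^ (-(α + 1))) :=
    (measurable_id.pow_const _).ennreal_ofReal
  have hlow : ∀ x, (Φ ‖x - x₀‖ * ∫⁻ t in Ioo ‖x - x₀‖ r₀, ENNReal.ofReal (t ^ (-(α + 1)))) *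
      μ {x₀} ^ s ≤ Φ ‖x - x₀‖ * wolffPart μ s α (Ioo ‖x - x₀‖ r₀) x := by
    intro x
    rw [mul_assoc, mul_comm (∫⁻ t in _, _), ← lintegral_const_mul _ hmeas]
    refine mul_le_mul_right (setLIntegral_mono' measurableSet_Ioo fun t ht => ?_) _
    refine mul_le_mul_left (ENNReal.rpow_le_rpow (measure_mono ?_) hs.le) _
    rw [singleton_subset_iff, Metric.mem_ball, dist_comm, dist_eq_norm]
    exact ht.1
  have hup : ∀ η, 0 < η → ∀ x, ‖x - x₀‖ ≤ η →
      Φ ‖x - x₀‖ * wolffPart μ s α (Ioo ‖x - x₀‖ r₀) x ≤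
      (Φ ‖x - x₀‖ * ∫⁻ t in Ioo ‖x - x₀‖ r₀, ENNReal.ofReal (t ^ (-(α + 1)))) *
        μ (Metric.closedBall x₀ (2 * η)) ^ s +
      Φ ‖x - x₀‖ * (μ univ ^ s * ∫⁻ t in Ioo η r₀, ENNReal.ofReal (t ^ (-(α + 1)))) := by
    intro η hη x hx
    rw [mul_assoc, ← mul_add, mul_comm (∫⁻ t in _, _), ← lintegral_const_mul _ hmeas,
      ← lintegral_const_mul _ hmeas]
    refine mul_le_mul_right ?_ _
    have hsub : Ioo ‖x - x₀‖ r₀ ⊆ (Ioo ‖x - x₀‖ r₀ ∩ Iic η) ∪ Ioo η r₀ := by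
      intro t ht
      rcases le_or_gt t η with h | h
      · exact Or.inl ⟨ht, h⟩
      · exact Or.inr ⟨h, ht.2⟩
    refine (lintegral_mono_set hsub).trans ((lintegral_union_le _ _ _).trans (add_le_add ?_ ?_))
    · refine le_trans (setLIntegral_mono' (measurableSet_Ioo.inter measurableSet_Iic)
        fun t ht => ?_) (lintegral_mono_set inter_subset_left)
      refine mul_le_mul_left (ENNReal.rpow_le_rpow (measure_mono ?_) hs.le) _
      refine (Metric.ball_subset_ball' ?_).trans Metric.ball_subset_closedBall
      have : t ≤ η := ht.2
      rw [dist_eq_norm]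
      linarith
    · refine setLIntegral_mono' measurableSet_Ioo fun t _ => ?_
      exact mul_le_mul_left (ENNReal.rpow_le_rpow (measure_mono (subset_univ _)) hs.le) _
  refine tendsto_order.2 ⟨fun b hb => ?_, fun b hb => ?_⟩
  · have := ENNReal.Tendsto.mul_const h1x (Or.inr (hm {x₀}))
    filter_upwards [this.eventually (lt_mem_nhds hb)] with x hx
    exact lt_of_lt_of_le hx (hlow x)
  · have hc : Tendsto (fun η => L * μ (Metric.closedBall x₀ (2 * η)) ^ s) (𝓝[>] 0)
        (𝓝 (L * μ {x₀} ^ s)) := by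
      refine ENNReal.Tendsto.const_mul ?_ (Or.inr hL)
      refine (ENNReal.continuous_rpow_const.tendsto _).comp
        ((tendsto_measure_closedBall μ x₀).comp ?_)
      refine tendsto_nhdsWithin_iff.2 ⟨?_, ?_⟩
      · have : Tendsto (fun η : ℝ => 2 * η) (𝓝 0) (𝓝 (2 * 0)) := tendsto_id.const_mul 2
        rw [mul_zero] at this
        exact this.mono_left nhdsWithin_le_nhds
      · filter_upwards [self_mem_nhdsWithin] with η hη
        exact mul_pos two_pos (mem_Ioi.1 hη)
    obtain ⟨η, hηb, hη⟩ := ((hc.eventually (gt_mem_nhds hb)).and self_mem_nhdsWithin).exists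
    have hη : 0 < η := hη
    have hfin : μ univ ^ s * ∫⁻ t in Ioo η r₀, ENNReal.ofReal (t ^ (-(α + 1))) ≠ ⊤ := by
      refine ENNReal.mul_ne_top (hm _) (ne_of_lt ?_)
      have hcont : ContinuousOn (fun t : ℝ => t ^ (-(α + 1))) (Icc η r₀) := fun t ht =>
        (Real.continuousAt_rpow_const _ _ (Or.inl
          (hη.trans_le ht.1).ne')).continuousWithinAt
      have hI := (hcont.integrableOn_Icc (μ := volume)).mono_set Ioo_subset_Icc_self
      exact (hI.lintegral_lt_top)
    have hsum := (ENNReal.Tendsto.mul_const h1x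
      (Or.inr (hm (Metric.closedBall x₀ (2 * η))))).add
        (ENNReal.Tendsto.mul_const h2x (Or.inr hfin))
    rw [zero_mul, add_zero] at hsum
    have hxη : ∀ᶠ x in 𝓝[≠] x₀, ‖x - x₀‖ ≤ η := by
      have := (hnorm.mono_right nhdsWithin_le_nhds).eventually (gt_mem_nhds hη)
      exact this.mono fun x hx => le_of_lt hx
    filter_upwards [hsum.eventually (gt_mem_nhds hηb), hxη] with x hx hx2
    exact lt_of_le_of_lt (hup η hη x hx2) hx

/-- The radii comparable to `|x - x₀|` and at most `|x - x₀|` do not see `x₀`, so their normalized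
contribution tends to `0`. -/
lemma tendsto_wolffPart_middle (μ : Measure (EuclideanSpace ℝ (Fin n))) [IsFiniteMeasure μ]
    (x₀ : EuclideanSpace ℝ (Fin n)) {s α : ℝ} (hs : 0 < s) (hα : 0 ≤ α) {Φ : ℝ → ℝ≥0∞}
    {c : ℝ≥0∞} (hc : c ≠ ⊤) (h3 : ∀ᶠ d in 𝓝[>] 0, Φ d * ENNReal.ofReal (d ^ (-α)) ≤ c) :
    Tendsto (fun x => Φ ‖x - x₀‖ * wolffPart μ s α (Icc (‖x - x₀‖ / 64) ‖x - x₀‖) x)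
      (𝓝[≠] x₀) (𝓝 0) := by
  have hnorm : Tendsto (fun x : EuclideanSpace ℝ (Fin n) => ‖x - x₀‖) (𝓝[≠] x₀) (𝓝[>] 0) :=
    tendsto_norm_sub_self_nhdsNE x₀
  have hnorm2 : Tendsto (fun x : EuclideanSpace ℝ (Fin n) => 2 * ‖x - x₀‖) (𝓝[≠] x₀) (𝓝[>] 0) := by
    refine tendsto_nhdsWithin_iff.2 ⟨?_, ?_⟩
    · have := (hnorm.mono_right nhdsWithin_le_nhds).const_mul 2
      rwa [mul_zero] at this
    · filter_upwards [hnorm.eventually self_mem_nhdsWithin] with x hx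
      exact mul_pos two_pos hx
  have hF : Tendsto (fun x => μ (Metric.closedBall x₀ (2 * ‖x - x₀‖) \ {x₀}) ^ s) (𝓝[≠] x₀)
      (𝓝 0) := by
    have := (ENNReal.continuous_rpow_const (y := s)).tendsto 0 |>.comp
      ((tendsto_measure_closedBall_diff μ x₀).comp hnorm2)
    rwa [ENNReal.zero_rpow_of_pos hs] at this
  have hlim := ENNReal.Tendsto.const_mul (a := c * ENNReal.ofReal ((64 : ℝ) ^ (α + 1))) hF
    (Or.inr (ENNReal.mul_ne_top hc ENNReal.ofReal_ne_top))
  rw [mul_zero] at hlim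
  refine tendsto_of_tendsto_of_tendsto_of_le_of_le' tendsto_const_nhds hlim
    (Eventually.of_forall fun _ => zero_le) ?_
  filter_upwards [hnorm.eventually h3, self_mem_nhdsWithin] with x hx hne
  set d := ‖x - x₀‖ with hd
  have hd0 : 0 < d := norm_pos_iff.2 (sub_ne_zero.2 hne)
  have hint : ∀ t ∈ Icc (d / 64) d, μ (Metric.ball x t) ^ s * ENNReal.ofReal (t ^ (-(α + 1))) ≤
      μ (Metric.closedBall x₀ (2 * d) \ {x₀}) ^ s *
        ENNReal.ofReal ((d / 64) ^ (-(α + 1))) := by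
    intro t ht
    refine mul_le_mul' (ENNReal.rpow_le_rpow (measure_mono fun y hy => ⟨?_, ?_⟩) hs.le)
      (ENNReal.ofReal_le_ofReal
        (Real.rpow_le_rpow_of_nonpos (by positivity) ht.1 (by linarith)))
    · refine (Metric.ball_subset_ball' ?_).trans Metric.ball_subset_closedBall hy
      rw [dist_eq_norm, ← hd]
      linarith [ht.2]
    · rintro rfl
      rw [Metric.mem_ball, dist_comm, dist_eq_norm, ← hd] at hy
      linarith [ht.2]
  have hvol : volume (Icc (d / 64) d) ≤ ENNReal.ofReal d := by
    rw [Real.volume_Icc]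
    exact ENNReal.ofReal_le_ofReal (by linarith)
  calc Φ d * wolffPart μ s α (Icc (d / 64) d) x
      ≤ Φ d * (μ (Metric.closedBall x₀ (2 * d) \ {x₀}) ^ s *
        ENNReal.ofReal ((d / 64) ^ (-(α + 1))) * ENNReal.ofReal d) := by
        refine mul_le_mul_right ((setLIntegral_mono measurable_const hint).trans ?_) _
        rw [setLIntegral_const]
        exact mul_le_mul_right hvol _
    _ = (Φ d * ENNReal.ofReal (d ^ (-α))) * ENNReal.ofReal ((64 : ℝ) ^ (α + 1)) *
        μ (Metric.closedBall x₀ (2 * d) \ {x₀}) ^ s := by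
        have e : ENNReal.ofReal ((d / 64) ^ (-(α + 1))) * ENNReal.ofReal d =
            ENNReal.ofReal (d ^ (-α)) * ENNReal.ofReal ((64 : ℝ) ^ (α + 1)) := by
          rw [← ENNReal.ofReal_mul (by positivity), ← ENNReal.ofReal_mul (by positivity),
            Real.div_rpow hd0.le (by norm_num), Real.rpow_neg (by norm_num : (0:ℝ) ≤ 64),
            neg_add, ← sub_eq_add_neg, Real.rpow_sub_one hd0.ne']
          congr 1
          field_simp
        rw [mul_assoc (μ _ ^ s), e]
        ring
    _ ≤ _ := by gcongr

/-- If, along `S`, the normalized contribution of the radii below `|x - x₀|/64` tends to `0`, then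
the normalized Wolff potential has the limit given by the atom of `μ` at `x₀`. -/
lemma tendsto_mul_wolff (μ : Measure (EuclideanSpace ℝ (Fin n))) [IsFiniteMeasure μ]
    (x₀ : EuclideanSpace ℝ (Fin n)) {p r₀ : ℝ} (hp : 1 < p) (hpn : p ≤ n)
    {Φ : ℝ → ℝ≥0∞} {L c : ℝ≥0∞} (hL : L ≠ ⊤) (hc : c ≠ ⊤)
    (h1 : Tendsto (fun d => Φ d * ∫⁻ t in Ioo d r₀,
      ENNReal.ofReal (t ^ (-(((n : ℝ) - p) / (p - 1) + 1)))) (𝓝[>] 0) (𝓝 L))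
    (h2 : Tendsto Φ (𝓝[>] 0) (𝓝 0))
    (h3 : ∀ᶠ d in 𝓝[>] 0, Φ d * ENNReal.ofReal (d ^ (-(((n : ℝ) - p) / (p - 1)))) ≤ c)
    {S : Set (EuclideanSpace ℝ (Fin n))} (hS : x₀ ∉ S)
    (h4 : Tendsto (fun x => Φ ‖x - x₀‖ * wolffPart μ (1 / (p - 1)) (((n : ℝ) - p) / (p - 1))
      (Ioo 0 (‖x - x₀‖ / 64)) x) (𝓝[S] x₀) (𝓝 0)) :
    Tendsto (fun x => Φ ‖x - x₀‖ * wolff p μ x r₀) (𝓝[S] x₀)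
      (𝓝 (L * μ {x₀} ^ (1 / (p - 1)))) := by
  have hp1 : 0 < p - 1 := by linarith
  have hs : 0 < 1 / (p - 1) := by positivity
  have hα : 0 ≤ ((n : ℝ) - p) / (p - 1) := div_nonneg (by linarith) hp1.le
  have hSne : 𝓝[S] x₀ ≤ 𝓝[≠] x₀ := nhdsWithin_mono _ fun x hx h => hS (h ▸ hx)
  have hout := (tendsto_wolffPart_outer μ x₀ hs hL h1 h2).mono_left hSne
  have hmid := (tendsto_wolffPart_middle μ x₀ hs hα hc h3).mono_left hSne
  have hsum := (h4.add hmid).add hout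
  rw [add_zero, zero_add] at hsum
  refine tendsto_of_tendsto_of_tendsto_of_le_of_le hout hsum (fun x => ?_) fun x => ?_
  · dsimp only
    rw [wolff_eq_wolffPart μ hp]
    exact mul_le_mul_right (lintegral_mono_set (Ioo_subset_Ioo_left (norm_nonneg _))) _
  · dsimp only
    rw [wolff_eq_wolffPart μ hp, ← mul_add, ← mul_add]
    refine mul_le_mul_right ?_ _
    have hsub : Ioo 0 r₀ ⊆
        (Ioo 0 (‖x - x₀‖ / 64) ∪ Icc (‖x - x₀‖ / 64) ‖x - x₀‖) ∪ Ioo ‖x - x₀‖ r₀ := by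
      intro t ht
      rcases lt_or_ge t (‖x - x₀‖ / 64) with h | h
      · exact Or.inl (Or.inl ⟨ht.1, h⟩)
      rcases le_or_gt t ‖x - x₀‖ with h' | h'
      · exact Or.inl (Or.inr ⟨h, h'⟩)
      · exact Or.inr ⟨h', ht.2⟩
    refine (lintegral_mono_set hsub).trans ((lintegral_union_le _ _ _).trans ?_)
    exact add_le_add (lintegral_union_le _ _ _) le_rfl

/-! ### The exceptional set -/

/-- A closed annulus slightly larger than `annulus x₀ i` and well inside `bigAnnulus x₀ i`. It
contains the balls of radius `2⁻ⁱ/4` about the points of `annulus x₀ i`. -/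
def fatAnnulus (x₀ : EuclideanSpace ℝ (Fin n)) (i : ℕ) : Set (EuclideanSpace ℝ (Fin n)) :=
  {x | 3 / 4 * (2 : ℝ) ^ (-(i : ℤ)) ≤ ‖x - x₀‖ ∧ ‖x - x₀‖ ≤ 9 / 4 * (2 : ℝ) ^ (-(i : ℤ))}

/-- The mass of the punctured closed ball of radius `4 · 2⁻ⁱ` about `x₀`. -/
def puncturedMass (μ : Measure (EuclideanSpace ℝ (Fin n))) (x₀ : EuclideanSpace ℝ (Fin n))
    (i : ℕ) : ℝ :=
  μ.real (Metric.closedBall x₀ (4 * (2 : ℝ) ^ (-(i : ℤ))) \ {x₀})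

/-- A null sequence `ε` that dominates the masses `μ(fatAnnulus x₀ i)`, even with
`∑ μ(fatAnnulus x₀ i) / εᵢ < ∞`. The summand `2⁻ⁱ` only makes it positive. -/
def threshold (μ : Measure (EuclideanSpace ℝ (Fin n))) (x₀ : EuclideanSpace ℝ (Fin n))
    (i : ℕ) : ℝ :=
  (1 + √(μ.real univ)) * √(puncturedMass μ x₀ i) + (2 : ℝ) ^ (-(i : ℤ))

lemma two_zpow_neg_add (i j : ℕ) :
    (2 : ℝ) ^ (-((i + j : ℕ) : ℤ)) = (2 : ℝ) ^ (-(i : ℤ)) / 2 ^ j := by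
  rw [zpow_neg, zpow_neg, zpow_natCast, zpow_natCast, pow_add]
  field_simp

lemma puncturedMass_nonneg (μ : Measure (EuclideanSpace ℝ (Fin n)))
    (x₀ : EuclideanSpace ℝ (Fin n)) (i : ℕ) : 0 ≤ puncturedMass μ x₀ i := measureReal_nonneg

lemma threshold_pos (μ : Measure (EuclideanSpace ℝ (Fin n))) (x₀ : EuclideanSpace ℝ (Fin n))
    (i : ℕ) : 0 < threshold μ x₀ i := by
  unfold threshold; positivity

lemma measurableSet_fatAnnulus (x₀ : EuclideanSpace ℝ (Fin n)) (i : ℕ) :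
    MeasurableSet (fatAnnulus x₀ i) :=
  have hc : Continuous fun x : EuclideanSpace ℝ (Fin n) => ‖x - x₀‖ := by fun_prop
  ((isClosed_le continuous_const hc).inter (isClosed_le hc continuous_const)).measurableSet

lemma measureReal_fatAnnulus_add_le (μ : Measure (EuclideanSpace ℝ (Fin n))) [IsFiniteMeasure μ]
    (x₀ : EuclideanSpace ℝ (Fin n)) (i : ℕ) :
    μ.real (fatAnnulus x₀ i) + puncturedMass μ x₀ (i + 3) ≤ puncturedMass μ x₀ i := by
  have hq : (0 : ℝ) < (2 : ℝ) ^ (-(i : ℤ)) := by positivity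
  unfold puncturedMass
  rw [two_zpow_neg_add]
  -- The ball of index `i + 3` has radius `2⁻ⁱ/2`, so it misses the annulus.
  rw [← measureReal_union]
  · refine measureReal_mono ?_
    rintro x (⟨h1, h2⟩ | ⟨h1, h2⟩)
    · refine ⟨?_, ?_⟩
      · rw [Metric.mem_closedBall, dist_eq_norm]; linarith
      · rintro rfl
        rw [sub_self, norm_zero] at h1
        linarith
    · refine ⟨Metric.closedBall_subset_closedBall ?_ h1, h2⟩
      linarith
  · rw [Set.disjoint_left]
    rintro x ⟨h1, -⟩ ⟨h2, -⟩
    rw [Metric.mem_closedBall, dist_eq_norm] at h2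
    linarith
  · exact Metric.isClosed_closedBall.measurableSet.diff (measurableSet_singleton _)

lemma measureReal_fatAnnulus_le_threshold (μ : Measure (EuclideanSpace ℝ (Fin n)))
    [IsFiniteMeasure μ] (x₀ : EuclideanSpace ℝ (Fin n)) (i : ℕ) :
    μ.real (fatAnnulus x₀ i) ≤ threshold μ x₀ i := by
  have h1 := measureReal_fatAnnulus_add_le μ x₀ i
  have h2 := puncturedMass_nonneg μ x₀ (i + 3)
  set F := puncturedMass μ x₀ i with hF
  have h3 : √F ≤ √(μ.real univ) := Real.sqrt_le_sqrt (measureReal_mono (subset_univ _))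
  have h4 : F = √F * √F := (Real.mul_self_sqrt (puncturedMass_nonneg μ x₀ i)).symm
  have h5 : (0 : ℝ) < (2 : ℝ) ^ (-(i : ℤ)) := by positivity
  have h6 := Real.sqrt_nonneg F
  unfold threshold
  rw [← hF]
  nlinarith

/-- Dividing by a multiple of the square root of the remaining mass makes the quotients
telescope. -/
lemma measureReal_fatAnnulus_div_threshold_le (μ : Measure (EuclideanSpace ℝ (Fin n)))
    [IsFiniteMeasure μ] (x₀ : EuclideanSpace ℝ (Fin n)) (i : ℕ) :
    μ.real (fatAnnulus x₀ i) / threshold μ x₀ i ≤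
      2 * (√(puncturedMass μ x₀ i) - √(puncturedMass μ x₀ (i + 3))) := by
  have h1 := measureReal_fatAnnulus_add_le μ x₀ i
  have h0 : 0 ≤ μ.real (fatAnnulus x₀ i) := measureReal_nonneg
  have hF' := puncturedMass_nonneg μ x₀ (i + 3)
  rw [div_le_iff₀ (threshold_pos μ x₀ i)]
  have hle : √(puncturedMass μ x₀ i) ≤ threshold μ x₀ i := by
    have : (0 : ℝ) < (2 : ℝ) ^ (-(i : ℤ)) := by positivity
    unfold threshold
    nlinarith [mul_nonneg (Real.sqrt_nonneg (μ.real univ))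
      (Real.sqrt_nonneg (puncturedMass μ x₀ i))]
  set F := puncturedMass μ x₀ i with hF
  set F' := puncturedMass μ x₀ (i + 3) with hF'_def
  have hFF : √F' ≤ √F := Real.sqrt_le_sqrt (by linarith)
  have e1 : √F * √F = F := Real.mul_self_sqrt (puncturedMass_nonneg μ x₀ i)
  have e2 : √F' * √F' = F' := Real.mul_self_sqrt hF'
  calc μ.real (fatAnnulus x₀ i) ≤ F - F' := by linarith
    _ = (√F - √F') * (√F + √F') := by linear_combination -e1 + e2
    _ ≤ (√F - √F') * (2 * threshold μ x₀ i) :=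
        mul_le_mul_of_nonneg_left (by linarith) (by linarith)
    _ = _ := by ring

lemma tsum_measureReal_fatAnnulus_div_threshold_lt_top (μ : Measure (EuclideanSpace ℝ (Fin n)))
    [IsFiniteMeasure μ] (x₀ : EuclideanSpace ℝ (Fin n)) :
    ∑' i, ENNReal.ofReal (μ.real (fatAnnulus x₀ i) / threshold μ x₀ i) < ⊤ := by
  set f : ℕ → ℝ := fun i => √(puncturedMass μ x₀ i) with hf
  refine lt_of_le_of_lt (b := ENNReal.ofReal (2 * (f 0 + f 1 + f 2)))
    (ENNReal.tsum_le_of_sum_range_le fun N => ?_) ENNReal.ofReal_lt_top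
  rw [← ENNReal.ofReal_sum_of_nonneg fun i _ =>
    div_nonneg measureReal_nonneg (threshold_pos μ x₀ i).le]
  refine ENNReal.ofReal_le_ofReal ?_
  refine (Finset.sum_le_sum fun i _ => measureReal_fatAnnulus_div_threshold_le μ x₀ i).trans ?_
  rw [← Finset.mul_sum]
  have htel := Finset.sum_range_sub' (fun i => f i + f (i + 1) + f (i + 2)) N
  have e : ∑ i ∈ Finset.range N, (f i - f (i + 3)) = ∑ i ∈ Finset.range N,
      (f i + f (i + 1) + f (i + 2) - (f (i + 1) + f (i + 1 + 1) + f (i + 1 + 2))) :=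
    Finset.sum_congr rfl fun i _ => by ring_nf
  have h0 : ∀ i, 0 ≤ f i := fun i => Real.sqrt_nonneg _
  change 2 * ∑ i ∈ Finset.range N, (f i - f (i + 3)) ≤ _
  rw [e, htel]
  simp only [zero_add]
  linarith [h0 N, h0 (N + 1), h0 (N + 2)]

lemma tendsto_two_zpow_neg : Tendsto (fun i : ℕ => (2 : ℝ) ^ (-(i : ℤ))) atTop (𝓝 0) := by
  simp_rw [zpow_neg, zpow_natCast, ← inv_pow]
  exact tendsto_pow_atTop_nhds_zero_of_lt_one (by norm_num) (by norm_num)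

lemma tendsto_threshold (μ : Measure (EuclideanSpace ℝ (Fin n))) [IsFiniteMeasure μ]
    (x₀ : EuclideanSpace ℝ (Fin n)) : Tendsto (threshold μ x₀) atTop (𝓝 0) := by
  have h1 : Tendsto (fun i : ℕ => 4 * (2 : ℝ) ^ (-(i : ℤ))) atTop (𝓝[>] 0) := by
    refine tendsto_nhdsWithin_iff.2 ⟨?_, Eventually.of_forall fun i => ?_⟩
    · simpa using tendsto_two_zpow_neg.const_mul 4
    · exact mem_Ioi.2 (by positivity)
  have h2 := (tendsto_measure_closedBall_diff μ x₀).comp h1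
  have h3 : Tendsto (puncturedMass μ x₀) atTop (𝓝 0) := by
    exact (ENNReal.tendsto_toReal ENNReal.zero_ne_top).comp h2
  have h4 : Tendsto (fun i => √(puncturedMass μ x₀ i)) atTop (𝓝 0) := by
    have := (Real.continuous_sqrt.tendsto 0).comp h3
    rwa [Real.sqrt_zero] at this
  have h5 := (h4.const_mul (1 + √(μ.real univ))).add tendsto_two_zpow_neg
  rwa [mul_zero, add_zero] at h5

lemma exists_mem_annulus {x₀ x : EuclideanSpace ℝ (Fin n)} (hx : x ≠ x₀) (h1 : ‖x - x₀‖ ≤ 1) :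
    ∃ i : ℕ, x ∈ annulus x₀ i := by
  obtain ⟨k, hk1, hk2⟩ := exists_nat_pow_near_of_lt_one
    (norm_pos_iff.2 (sub_ne_zero.2 hx)) h1 (by norm_num : (0 : ℝ) < 1 / 2) (by norm_num)
  refine ⟨k + 1, ?_, ?_⟩
  · refine le_trans (le_of_eq ?_) hk1.le
    rw [zpow_neg, zpow_natCast, one_div, inv_pow]
  · refine hk2.trans (le_of_eq ?_)
    rw [zpow_add₀ (by norm_num), zpow_neg, zpow_natCast, one_div, inv_pow, pow_succ]
    field_simp

lemma cthickening_fatAnnulus_subset (x₀ : EuclideanSpace ℝ (Fin n)) (i : ℕ) :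
    Metric.cthickening (2 * ((2 : ℝ) ^ (-(i : ℤ)) / 16)) (fatAnnulus x₀ i) ⊆ bigAnnulus x₀ i := by
  intro x hx
  have hq : (0 : ℝ) < (2 : ℝ) ^ (-(i : ℤ)) := by positivity
  set q := (2 : ℝ) ^ (-(i : ℤ)) with hq_def
  have hx' := Metric.cthickening_subset_thickening' (δ₂ := q / 6) (by positivity)
    (by linarith) _ hx
  obtain ⟨z, ⟨hz1, hz2⟩, hxz⟩ := Metric.mem_thickening_iff.1 hx'
  rw [dist_eq_norm] at hxz
  have h1 : ‖x - x₀‖ ≤ ‖x - z‖ + ‖z - x₀‖ := norm_sub_le_norm_sub_add_norm_sub _ _ _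
  have h2 : ‖z - x₀‖ ≤ ‖x - z‖ + ‖x - x₀‖ := by
    rw [norm_sub_rev x z]
    exact norm_sub_le_norm_sub_add_norm_sub _ _ _
  rw [← hq_def] at hz1 hz2
  refine ⟨?_, ?_⟩
  · rw [zpow_sub₀ (by norm_num), ← hq_def, zpow_one]
    linarith
  · rw [zpow_add₀ (by norm_num), ← hq_def]
    norm_num
    linarith

/-- The exceptional set, with the bounds for its capacity and for the small radii off it. On the
`i`-th annulus it lies in the open set given by the weak-type estimate for `μ` restricted to
`fatAnnulus x₀ i`, at the level `wᵢ (εᵢ / Rᵢ^{n-p})^{1/(p-1)}`, with `Rᵢ = 2⁻ⁱ/16` and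
`εᵢ = threshold μ x₀ i`. A point common to two annuli has to lie in both open sets. -/
lemma exists_exceptional_set (n : ℕ) {p : ℝ} (hp : 1 < p) (hpn : p ≤ n) :
    ∃ C : ℝ, 0 < C ∧ ∀ (μ : Measure (EuclideanSpace ℝ (Fin n))) [IsFiniteMeasure μ]
      (x₀ : EuclideanSpace ℝ (Fin n)) (Ω : Set (EuclideanSpace ℝ (Fin n))) (w : ℕ → ℝ),
      (∀ i, 1 ≤ w i) → ∃ E ⊆ Ω,
        (∀ i : ℕ, cap p (E ∩ annulus x₀ i) (bigAnnulus x₀ i) ≤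
          ENNReal.ofReal (C * ((2 : ℝ) ^ (-(i : ℤ))) ^ ((n : ℝ) - p) * w i ^ (1 - p) *
            (μ.real (fatAnnulus x₀ i) / threshold μ x₀ i))) ∧
        ∀ x ∈ Ω, x ∉ E → x ≠ x₀ → ‖x - x₀‖ ≤ 1 → ∃ i, x ∈ annulus x₀ i ∧
          wolffPart μ (1 / (p - 1)) (((n : ℝ) - p) / (p - 1)) (Ioo 0 (‖x - x₀‖ / 64)) x ≤
            ENNReal.ofReal (C * w i * threshold μ x₀ i ^ (1 / (p - 1)) *
              ((2 : ℝ) ^ (-(i : ℤ))) ^ (-(((n : ℝ) - p) / (p - 1)))) := by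
  obtain ⟨C, hC, hcap⟩ := exists_isOpen_capCompact_le n hp hpn
  have hp1 : 0 < p - 1 := by linarith
  set s := 1 / (p - 1) with hs_def
  have hs : 0 < s := by positivity
  set a := (n : ℝ) - p with ha_def
  have ha : 0 ≤ a := by rw [ha_def]; linarith
  have has : a / (p - 1) = a * s := by rw [hs_def, mul_one_div]
  refine ⟨C + (4 : ℝ) ^ (a * s) * C * (16 : ℝ) ^ (a * s), by positivity, ?_⟩
  intro μ _ x₀ Ω w hw
  set q : ℕ → ℝ := fun i => (2 : ℝ) ^ (-(i : ℤ)) with hq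
  have hq0 : ∀ i, 0 < q i := fun i => by simp only [hq]; positivity
  set R : ℕ → ℝ := fun i => q i / 16 with hR
  have hR0 : ∀ i, 0 < R i := fun i => by simp only [hR]; have := hq0 i; positivity
  set ε : ℕ → ℝ := threshold μ x₀ with hε
  have hε0 : ∀ i, 0 < ε i := threshold_pos μ x₀
  set lam : ℕ → ℝ := fun i => w i * (ε i / R i ^ a) ^ s with hlam
  have hlam0 : ∀ i, 0 < lam i := fun i => by
    have := hw i; have := hR0 i; have := hε0 i
    simp only [hlam]; positivity
  have hbdd : ∀ i, Bornology.IsBounded (fatAnnulus x₀ i) := fun i =>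
    Metric.isBounded_closedBall.subset fun x hx => by
      rw [Metric.mem_closedBall, dist_eq_norm]; exact hx.2
  have hG : ∀ i, ∃ G : Set (EuclideanSpace ℝ (Fin n)), IsOpen G ∧ G ⊆ bigAnnulus x₀ i ∧
        (∀ K, IsCompact K → K ⊆ G → capCompact p K (bigAnnulus x₀ i) ≤
          ENNReal.ofReal (C * lam i ^ (1 - p)) * (μ.restrict (fatAnnulus x₀ i)) univ) ∧
        ∀ x ∉ G, ∀ N, ∑ j ∈ Finset.range N, massRatio (μ.restrict (fatAnnulus x₀ i)) s a
          (R i / 2 ^ j) (R i / 2 ^ j / 2) x ≤ C * lam i := by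
    intro i
    refine hcap (μ.restrict (fatAnnulus x₀ i)) (R i) (lam i) (fatAnnulus x₀ i) (bigAnnulus x₀ i)
      (hR0 i) (hlam0 i) (hbdd i) ?_ (cthickening_fatAnnulus_subset x₀ i) ?_
    · rw [Measure.restrict_apply (measurableSet_fatAnnulus x₀ i).compl, Set.compl_inter_self,
        measure_empty]
    · have hu : (μ.restrict (fatAnnulus x₀ i)).real univ = μ.real (fatAnnulus x₀ i) := by
        simp [measureReal_def]
      rw [hu]
      have h1 : (μ.real (fatAnnulus x₀ i) / R i ^ a) ^ s ≤ (ε i / R i ^ a) ^ s := by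
        have := measureReal_fatAnnulus_le_threshold μ x₀ i
        have := hR0 i
        gcongr
      refine h1.trans ?_
      have : 0 ≤ (ε i / R i ^ a) ^ s := by have := hR0 i; have := hε0 i; positivity
      simp only [hlam]
      nlinarith [hw i]
  choose G hGo hGU hGc hGs using hG
  refine ⟨{x | x ∈ Ω ∧ (∃ i, x ∈ annulus x₀ i) ∧ ∀ i, x ∈ annulus x₀ i → x ∈ G i},
    fun x hx => hx.1, fun i => ?_, fun x hxΩ hxE hne h1 => ?_⟩
  · refine cap_le_of_isOpen (hGo i) (fun x hx => hx.1.2.2 i hx.2) (hGU i) fun K hK hKG => ?_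
    refine (hGc i K hK hKG).trans ?_
    rw [Measure.restrict_apply_univ, ← ofReal_measureReal (measure_ne_top _ _),
      ← ENNReal.ofReal_mul (by have := hlam0 i; positivity)]
    refine ENNReal.ofReal_le_ofReal ?_
    have hlp : lam i ^ (1 - p) = w i ^ (1 - p) * (R i ^ a / ε i) := by
      have h0 : 0 ≤ ε i / R i ^ a := by have := hR0 i; have := hε0 i; positivity
      have hsp : s * (1 - p) = -1 := by rw [hs_def]; field_simp; ring
      simp only [hlam]
      rw [Real.mul_rpow (by linarith [hw i]) (by positivity), ← Real.rpow_mul h0, hsp,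
        Real.rpow_neg_one, inv_div]
    have hRq : R i ^ a ≤ q i ^ a :=
      Real.rpow_le_rpow (hR0 i).le (by simp only [hR]; linarith [hq0 i]) ha
    rw [hlp]
    have hm : 0 ≤ μ.real (fatAnnulus x₀ i) := measureReal_nonneg
    have hw0 : 0 ≤ w i ^ (1 - p) := Real.rpow_nonneg (by linarith [hw i]) _
    have hεi := hε0 i
    have hqi := hq0 i
    calc C * (w i ^ (1 - p) * (R i ^ a / ε i)) * μ.real (fatAnnulus x₀ i)
        = C * R i ^ a * w i ^ (1 - p) * (μ.real (fatAnnulus x₀ i) / ε i) := by ring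
      _ ≤ _ := by
          gcongr
          · have : 0 ≤ (4 : ℝ) ^ (a * s) * C * (16 : ℝ) ^ (a * s) := by positivity
            linarith
  · obtain ⟨i, hi, hiG⟩ : ∃ i, x ∈ annulus x₀ i ∧ x ∉ G i := by
      by_contra! h
      exact hxE ⟨hxΩ, exists_mem_annulus hne h1, h⟩
    refine ⟨i, hi, ?_⟩
    have hi1 : q i ≤ ‖x - x₀‖ := hi.1
    have hi2 : ‖x - x₀‖ ≤ 2 * q i := by
      refine hi.2.trans (le_of_eq ?_)
      rw [zpow_add₀ (by norm_num), zpow_one, mul_comm]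
    have hball : Metric.ball x (R i / 2) ⊆ fatAnnulus x₀ i := by
      intro z hz
      rw [Metric.mem_ball, dist_eq_norm] at hz
      have h1 : ‖z - x₀‖ ≤ ‖z - x‖ + ‖x - x₀‖ := norm_sub_le_norm_sub_add_norm_sub _ _ _
      have h2 : ‖x - x₀‖ ≤ ‖z - x‖ + ‖z - x₀‖ := by
        rw [norm_sub_rev z x]
        exact norm_sub_le_norm_sub_add_norm_sub _ _ _
      have h3 : ‖z - x‖ < q i / 16 / 2 := hz
      have := hq0 i
      refine ⟨?_, ?_⟩
      · change 3 / 4 * q i ≤ _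
        linarith
      · change _ ≤ 9 / 4 * q i
        linarith
    have hsmall := wolffPart_Ioo_le_of_sum_le μ hs.le ha (hR0 i) hball (hGs i x hiG)
    rw [has]
    -- `‖x - x₀‖ / 64 ≤ 2⁻ⁱ/32 = R i / 2`, so the small radii are covered by the dyadic sum.
    refine (lintegral_mono_set (Ioo_subset_Ioo_right ?_)).trans (hsmall.trans
      (ENNReal.ofReal_le_ofReal ?_))
    · simp only [hR]; linarith
    · have hqi := hq0 i
      have hεi := hε0 i
      have hwi : 0 ≤ w i := by linarith [hw i]
      have e : lam i = w i * (ε i ^ s * ((16 : ℝ) ^ (a * s) * q i ^ (-(a * s)))) := by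
        simp only [hlam, hR]
        rw [Real.div_rpow hεi.le (by positivity), ← Real.rpow_mul (by positivity),
          Real.div_rpow hqi.le (by norm_num), Real.rpow_neg hqi.le]
        field_simp
      rw [e]
      have h0 : 0 ≤ C * w i * ε i ^ s * q i ^ (-(a * s)) := by positivity
      calc _ = ((4 : ℝ) ^ (a * s) * C * (16 : ℝ) ^ (a * s)) * w i * ε i ^ s * q i ^ (-(a * s)) := by
            ring
        _ ≤ _ := by
            change _ ≤ (C + (4 : ℝ) ^ (a * s) * C * (16 : ℝ) ^ (a * s)) * w i * ε i ^ s *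
              q i ^ (-(a * s))
            linarith

/-- As `x → x₀`, the index of any dyadic annulus containing `x` tends to infinity. -/
lemma tendsto_zero_of_annulus {x₀ : EuclideanSpace ℝ (Fin n)}
    {S : Set (EuclideanSpace ℝ (Fin n))} {f : EuclideanSpace ℝ (Fin n) → ℝ≥0∞} {b : ℕ → ℝ≥0∞}
    (hb : Tendsto b atTop (𝓝 0)) (h : ∀ᶠ x in 𝓝[S] x₀, ∃ i, x ∈ annulus x₀ i ∧ f x ≤ b i) :
    Tendsto f (𝓝[S] x₀) (𝓝 0) := by
  rw [ENNReal.tendsto_nhds_zero] at hb ⊢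
  intro ε hε
  obtain ⟨I, hI⟩ := eventually_atTop.1 (hb ε hε)
  have hq : (0 : ℝ) < (2 : ℝ) ^ (-(I : ℤ)) := by positivity
  filter_upwards [h, mem_nhdsWithin_of_mem_nhds (Metric.ball_mem_nhds x₀ hq)] with x hx hball
  obtain ⟨i, hi, hfi⟩ := hx
  refine hfi.trans (hI i ?_)
  rw [Metric.mem_ball, dist_eq_norm] at hball
  have hlt := hi.1.trans_lt hball
  rw [zpow_lt_zpow_iff_right₀ (by norm_num : (1 : ℝ) < 2)] at hlt
  omega

/-! ### Thinness and the limits -/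

lemma tsum_lt_top_of_le_threshold (μ : Measure (EuclideanSpace ℝ (Fin n))) [IsFiniteMeasure μ]
    (x₀ : EuclideanSpace ℝ (Fin n)) {f : ℕ → ℝ≥0∞} (K : ℝ)
    (h : ∀ i, f i ≤ ENNReal.ofReal K *
      ENNReal.ofReal (μ.real (fatAnnulus x₀ (i + 1)) / threshold μ x₀ (i + 1))) :
    ∑' i, f i < ⊤ := by
  refine (ENNReal.tsum_le_tsum h).trans_lt ?_
  rw [ENNReal.tsum_mul_left]
  refine ENNReal.mul_lt_top ENNReal.ofReal_lt_top (lt_of_le_of_lt ?_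
    (tsum_measureReal_fatAnnulus_div_threshold_lt_top μ x₀))
  exact ENNReal.tsum_comp_le_tsum_of_injective (add_left_injective 1)
    fun i => ENNReal.ofReal (μ.real (fatAnnulus x₀ i) / threshold μ x₀ i)

lemma tendsto_ofReal_mul_threshold_rpow (μ : Measure (EuclideanSpace ℝ (Fin n)))
    [IsFiniteMeasure μ] (x₀ : EuclideanSpace ℝ (Fin n)) {s : ℝ} (hs : 0 < s) (K : ℝ) :
    Tendsto (fun i => ENNReal.ofReal (K * threshold μ x₀ i ^ s)) atTop (𝓝 0) := by
  have h := ((tendsto_threshold μ x₀).rpow_const (Or.inr hs.le)).const_mul K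
  rw [Real.zero_rpow hs.ne', mul_zero] at h
  simpa using ENNReal.tendsto_ofReal h

lemma lintegral_Ioo_rpow_eq {d r₀ : ℝ} (hd : 0 < d) (hdr : d ≤ r₀) (β : ℝ) :
    ∫⁻ t in Ioo d r₀, ENNReal.ofReal (t ^ β) = ENNReal.ofReal (∫ t in d..r₀, t ^ β) := by
  have hcont : ContinuousOn (fun t : ℝ => t ^ β) (Icc d r₀) := fun t ht =>
    (Real.continuousAt_rpow_const _ _ (Or.inl (hd.trans_le ht.1).ne')).continuousWithinAt
  rw [intervalIntegral.integral_of_le hdr, integral_Ioc_eq_integral_Ioo,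
    ofReal_integral_eq_lintegral_ofReal (hcont.integrableOn_Icc.mono_set Ioo_subset_Icc_self)]
  filter_upwards [ae_restrict_mem measurableSet_Ioo] with t ht
  exact Real.rpow_nonneg (hd.trans ht.1).le _

lemma tendsto_rpow_nhdsGT_zero {α : ℝ} (hα : 0 < α) :
    Tendsto (fun d : ℝ => d ^ α) (𝓝[>] 0) (𝓝 0) := by
  have := (Real.continuousAt_rpow_const 0 α (Or.inr hα.le)).tendsto
  rw [Real.zero_rpow hα.ne'] at this
  exact this.mono_left nhdsWithin_le_nhds

lemma tendsto_ofReal_rpow_mul_lintegral {α r₀ : ℝ} (hα : 0 < α) (hr₀ : 0 < r₀) :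
    Tendsto (fun d : ℝ => ENNReal.ofReal (d ^ α) *
      ∫⁻ t in Ioo d r₀, ENNReal.ofReal (t ^ (-(α + 1)))) (𝓝[>] 0) (𝓝 (ENNReal.ofReal (1 / α))) := by
  have h : Tendsto (fun d : ℝ => ENNReal.ofReal ((1 - d ^ α * r₀ ^ (-α)) / α)) (𝓝[>] 0)
      (𝓝 (ENNReal.ofReal ((1 - 0 * r₀ ^ (-α)) / α))) :=
    ENNReal.tendsto_ofReal
      ((((tendsto_rpow_nhdsGT_zero hα).mul_const _).const_sub 1).div_const α)
  rw [zero_mul, sub_zero] at h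
  refine h.congr' ?_
  filter_upwards [Ioo_mem_nhdsGT hr₀] with d hd
  have hd0 : 0 < d := hd.1
  rw [lintegral_Ioo_rpow_eq hd0 hd.2.le, ← ENNReal.ofReal_mul (by positivity), integral_rpow]
  · congr 1
    rw [show -(α + 1) + 1 = -α by ring, Real.rpow_neg hd0.le]
    field_simp
    ring
  · right
    refine ⟨by linarith, ?_⟩
    rw [uIcc_of_le hd.2.le]
    exact fun h => absurd h.1 (not_le.2 hd0)

lemma tendsto_log_one_div : Tendsto (fun d : ℝ => Real.log (1 / d)) (𝓝[>] 0) atTop := by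
  simp_rw [one_div, Real.log_inv]
  exact tendsto_neg_atBot_atTop.comp (Real.tendsto_log_nhdsNE_zero.mono_left
    (nhdsWithin_mono _ fun x hx => (mem_Ioi.1 hx).ne'))

lemma tendsto_inv_log_mul_lintegral {r₀ : ℝ} (hr₀ : 0 < r₀) :
    Tendsto (fun d : ℝ => (ENNReal.ofReal (Real.log (1 / d)))⁻¹ *
      ∫⁻ t in Ioo d r₀, ENNReal.ofReal (t ^ (-(0 + 1) : ℝ))) (𝓝[>] 0) (𝓝 1) := by
  have h : Tendsto (fun d : ℝ => ENNReal.ofReal (Real.log r₀ / Real.log (1 / d) + 1)) (𝓝[>] 0)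
      (𝓝 (ENNReal.ofReal (0 + 1))) :=
    ENNReal.tendsto_ofReal ((tendsto_log_one_div.const_div_atTop _).add_const 1)
  rw [zero_add, ENNReal.ofReal_one] at h
  refine h.congr' ?_
  filter_upwards [Ioo_mem_nhdsGT hr₀, Ioo_mem_nhdsGT one_pos] with d hd hd1
  have hd0 : 0 < d := hd.1
  have hlog : 0 < Real.log (1 / d) := Real.log_pos (by rw [one_lt_div hd0]; exact hd1.2)
  rw [lintegral_Ioo_rpow_eq hd0 hd.2.le, ← ENNReal.ofReal_inv_of_pos hlog,
    ← ENNReal.ofReal_mul (by positivity)]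
  congr 1
  have e : ∫ t in d..r₀, t ^ (-(0 + 1) : ℝ) = Real.log (r₀ / d) := by
    rw [← integral_inv_of_pos hd0 hr₀]
    simp_rw [zero_add, Real.rpow_neg_one]
  rw [e, div_eq_mul_one_div r₀ d, Real.log_mul hr₀.ne' (by positivity)]
  field_simp

lemma isPThin_of_cap_le {p : ℝ} (hn : 0 < n) (hp : 1 < p)
    (μ : Measure (EuclideanSpace ℝ (Fin n))) [IsFiniteMeasure μ] (x₀ : EuclideanSpace ℝ (Fin n))
    {E : Set (EuclideanSpace ℝ (Fin n))} {C : ℝ}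
    (h : ∀ i : ℕ, cap p (E ∩ annulus x₀ i) (bigAnnulus x₀ i) ≤
      ENNReal.ofReal (C * ((2 : ℝ) ^ (-(i : ℤ))) ^ ((n : ℝ) - p) *
        (μ.real (fatAnnulus x₀ i) / threshold μ x₀ i))) :
    IsPThin p E x₀ := by
  obtain ⟨c, hc, hsphere⟩ := exists_le_capCompact_sphere (p := p) hn hp
  refine tsum_lt_top_of_le_threshold μ x₀ (C / c) fun i => ?_
  have hq : (0 : ℝ) < (2 : ℝ) ^ (-((i + 1 : ℕ) : ℤ)) := by positivity
  have h2 := (hsphere x₀ _ hq).trans (capCompact_le_cap (isCompact_sphere _ _))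
  have hcap := h (i + 1)
  rw [zpow_add₀ (by norm_num : (2 : ℝ) ≠ 0), zpow_one, mul_comm _ (2 : ℝ)]
  set q : ℝ := (2 : ℝ) ^ (-((i + 1 : ℕ) : ℤ)) with hq_def
  set m := μ.real (fatAnnulus x₀ (i + 1)) / threshold μ x₀ (i + 1) with hm
  have hm0 : 0 ≤ m := div_nonneg measureReal_nonneg (threshold_pos μ x₀ _).le
  refine (ENNReal.div_le_div hcap h2).trans (le_of_eq ?_)
  rw [← ENNReal.ofReal_div_of_pos (by positivity), ← ENNReal.ofReal_mul' hm0]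
  congr 1
  field_simp

lemma isNThin_of_cap_le (hn : 2 ≤ n) (μ : Measure (EuclideanSpace ℝ (Fin n))) [IsFiniteMeasure μ]
    (x₀ : EuclideanSpace ℝ (Fin n)) {E : Set (EuclideanSpace ℝ (Fin n))} {C : ℝ} (hC : 0 < C)
    (h : ∀ i : ℕ, cap (n : ℝ) (E ∩ annulus x₀ i) (bigAnnulus x₀ i) ≤
      ENNReal.ofReal (C * ((i : ℝ) + 1) ^ (1 - (n : ℝ)) *
        (μ.real (fatAnnulus x₀ i) / threshold μ x₀ i))) :
    IsNThin E x₀ := by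
  refine tsum_lt_top_of_le_threshold μ x₀ C fun i => ?_
  set m := μ.real (fatAnnulus x₀ (i + 1)) / threshold μ x₀ (i + 1) with hm
  have hm0 : 0 ≤ m := div_nonneg measureReal_nonneg (threshold_pos μ x₀ _).le
  refine (mul_le_mul_right (h (i + 1)) _).trans ?_
  rw [← ENNReal.ofReal_natCast, ← ENNReal.ofReal_pow (by positivity),
    ← ENNReal.ofReal_mul (by positivity), ← ENNReal.ofReal_mul' hm0]
  refine ENNReal.ofReal_le_ofReal ?_
  set y : ℝ := ((i + 1 : ℕ) : ℝ) with hy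
  have hy0 : 0 < y := by rw [hy]; positivity
  have e : (y + 1) ^ (1 - (n : ℝ)) = ((y + 1) ^ (n - 1))⁻¹ := by
    rw [← Real.rpow_natCast, ← Real.rpow_neg (by positivity), Nat.cast_sub (by omega), Nat.cast_one,
      neg_sub]
  have hle : y ^ (n - 1) * ((y + 1) ^ (n - 1))⁻¹ ≤ 1 := by
    rw [← div_eq_mul_inv, div_le_one (by positivity)]
    exact pow_le_pow_left₀ hy0.le (by linarith) _
  rw [e]
  calc y ^ (n - 1) * (C * ((y + 1) ^ (n - 1))⁻¹ * m)
      = (y ^ (n - 1) * ((y + 1) ^ (n - 1))⁻¹) * (C * m) := by ring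
    _ ≤ 1 * (C * m) := mul_le_mul_of_nonneg_right hle (by positivity)
    _ = C * m := one_mul _

lemma eventually_mem_and_norm_le {Ω E : Set (EuclideanSpace ℝ (Fin n))}
    {x₀ : EuclideanSpace ℝ (Fin n)} (hΩ : Ω ∈ 𝓝 x₀) {r : ℝ} (hr : 0 < r) :
    ∀ᶠ x in 𝓝[{x | x ≠ x₀ ∧ x ∉ E}] x₀, x ∈ Ω ∧ x ∉ E ∧ x ≠ x₀ ∧ ‖x - x₀‖ ≤ r := by
  filter_upwards [self_mem_nhdsWithin, mem_nhdsWithin_of_mem_nhds hΩ,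
    mem_nhdsWithin_of_mem_nhds (Metric.closedBall_mem_nhds x₀ hr)] with x h1 h2 h3
  exact ⟨h2, h1.2, h1.1, by rwa [Metric.mem_closedBall, dist_eq_norm] at h3⟩

lemma exists_isPThin_tendsto {p : ℝ} (hp : 1 < p) (hpn : p < n)
    (μ : Measure (EuclideanSpace ℝ (Fin n))) [IsFiniteMeasure μ]
    {Ω : Set (EuclideanSpace ℝ (Fin n))} {x₀ : EuclideanSpace ℝ (Fin n)} (hΩ : Ω ∈ 𝓝 x₀)
    {r₀ : ℝ} (hr₀ : 0 < r₀) :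
    ∃ E ⊆ Ω, IsPThin p E x₀ ∧
      Tendsto (fun x => ENNReal.ofReal (‖x - x₀‖ ^ (((n : ℝ) - p) / (p - 1))) * wolff p μ x r₀)
        (𝓝[{x | x ≠ x₀ ∧ x ∉ E}] x₀)
        (𝓝 (ENNReal.ofReal ((p - 1) / ((n : ℝ) - p)) * μ {x₀} ^ (1 / (p - 1)))) := by
  have hp1 : 0 < p - 1 := by linarith
  have hs : 0 < 1 / (p - 1) := by positivity
  have hα : 0 < ((n : ℝ) - p) / (p - 1) := div_pos (by linarith) hp1
  have hn : 0 < n := by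
    have : (0 : ℝ) < n := by linarith
    exact_mod_cast this
  obtain ⟨C, hC, hex⟩ := exists_exceptional_set n hp hpn.le
  obtain ⟨E, hEΩ, hcap, hsmall⟩ := hex μ x₀ Ω (fun _ => 1) (fun _ => le_rfl)
  refine ⟨E, hEΩ, isPThin_of_cap_le (C := C) hn hp μ x₀ fun i => by simpa using hcap i, ?_⟩
  set α := ((n : ℝ) - p) / (p - 1) with hα_def
  have h1 := tendsto_ofReal_rpow_mul_lintegral hα hr₀
  rw [hα_def, one_div_div, ← hα_def] at h1
  have h2 : Tendsto (fun d : ℝ => ENNReal.ofReal (d ^ α)) (𝓝[>] 0) (𝓝 0) := by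
    simpa using ENNReal.tendsto_ofReal (tendsto_rpow_nhdsGT_zero hα)
  refine tendsto_mul_wolff μ x₀ hp hpn.le (Φ := fun d => ENNReal.ofReal (d ^ α)) (c := 1)
    ENNReal.ofReal_ne_top ENNReal.one_ne_top h1 h2 ?_ (fun h => h.1 rfl) ?_
  · filter_upwards [self_mem_nhdsWithin] with d hd
    have hd : 0 < d := hd
    rw [← ENNReal.ofReal_mul (by positivity), ← Real.rpow_add hd, ← hα_def, add_neg_cancel,
      Real.rpow_zero, ENNReal.ofReal_one]
  · refine tendsto_zero_of_annulus
      (tendsto_ofReal_mul_threshold_rpow μ x₀ hs ((2 : ℝ) ^ α * C)) ?_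
    filter_upwards [eventually_mem_and_norm_le (E := E) hΩ one_pos] with x hx
    obtain ⟨i, hi, hle⟩ := hsmall x hx.1 hx.2.1 hx.2.2.1 hx.2.2.2
    refine ⟨i, hi, ?_⟩
    have hq : (0 : ℝ) < (2 : ℝ) ^ (-(i : ℤ)) := by positivity
    have hd2 : ‖x - x₀‖ ≤ 2 * (2 : ℝ) ^ (-(i : ℤ)) := by
      refine hi.2.trans (le_of_eq ?_)
      rw [zpow_add₀ (by norm_num), zpow_one, mul_comm]
    have hε := threshold_pos μ x₀ i
    refine (mul_le_mul' (ENNReal.ofReal_le_ofReal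
      (Real.rpow_le_rpow (norm_nonneg _) hd2 hα.le)) hle).trans (le_of_eq ?_)
    rw [← ENNReal.ofReal_mul (by positivity)]
    congr 1
    rw [Real.mul_rpow (by norm_num) hq.le, Real.rpow_neg hq.le]
    field_simp

lemma exists_isNThin_tendsto (hn : 2 ≤ n)
    (μ : Measure (EuclideanSpace ℝ (Fin n))) [IsFiniteMeasure μ]
    {Ω : Set (EuclideanSpace ℝ (Fin n))} {x₀ : EuclideanSpace ℝ (Fin n)} (hΩ : Ω ∈ 𝓝 x₀)
    {r₀ : ℝ} (hr₀ : 0 < r₀) :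
    ∃ E ⊆ Ω, IsNThin E x₀ ∧
      Tendsto (fun x => wolff (n : ℝ) μ x r₀ / ENNReal.ofReal (Real.log (1 / ‖x - x₀‖)))
        (𝓝[{x | x ≠ x₀ ∧ x ∉ E}] x₀) (𝓝 (μ {x₀} ^ (1 / ((n : ℝ) - 1)))) := by
  have hn2 : (2 : ℝ) ≤ n := by exact_mod_cast hn
  have hp : (1 : ℝ) < n := by linarith
  have hp1 : (0 : ℝ) < n - 1 := by linarith
  have hs : 0 < 1 / ((n : ℝ) - 1) := by positivity
  have hα : ((n : ℝ) - n) / (n - 1) = 0 := by simp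
  obtain ⟨C, hC, hex⟩ := exists_exceptional_set n hp le_rfl
  obtain ⟨E, hEΩ, hcap, hsmall⟩ := hex μ x₀ Ω (fun i => (i : ℝ) + 1) (fun i => by
    have : (0 : ℝ) ≤ i := by positivity
    linarith)
  refine ⟨E, hEΩ, isNThin_of_cap_le hn μ x₀ hC fun i => by simpa using hcap i, ?_⟩
  have h1 := tendsto_inv_log_mul_lintegral hr₀
  have h2 : Tendsto (fun d : ℝ => (ENNReal.ofReal (Real.log (1 / d)))⁻¹) (𝓝[>] 0) (𝓝 0) := by
    have := ENNReal.tendsto_ofReal_atTop.comp tendsto_log_one_div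
    simpa using tendsto_inv_iff.2 this
  have h3 : ∀ᶠ d : ℝ in 𝓝[>] 0, (ENNReal.ofReal (Real.log (1 / d)))⁻¹ *
      ENNReal.ofReal (d ^ (-(((n : ℝ) - n) / (n - 1)))) ≤ 1 := by
    rw [hα]
    filter_upwards [h2.eventually (gt_mem_nhds one_pos)] with d hd
    simpa using hd.le
  have key := tendsto_mul_wolff μ x₀ hp le_rfl (r₀ := r₀)
    (Φ := fun d => (ENNReal.ofReal (Real.log (1 / d)))⁻¹) (L := 1) (c := 1)
    ENNReal.one_ne_top ENNReal.one_ne_top (by rw [hα]; exact h1) h2 h3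
    (S := {x | x ≠ x₀ ∧ x ∉ E}) (fun h => h.1 rfl) ?_
  · rw [one_mul] at key
    exact key.congr fun x => (mul_comm _ _).trans (div_eq_mul_inv _ _).symm
  · have hb : Tendsto (fun i : ℕ => (ENNReal.ofReal (((i : ℝ) - 1) * Real.log 2))⁻¹ *
        ENNReal.ofReal (C * ((i : ℝ) + 1) * threshold μ x₀ i ^ (1 / ((n : ℝ) - 1))))
        atTop (𝓝 0) := by
      have hlog2 : 0 < Real.log 2 := Real.log_pos (by norm_num)
      refine tendsto_of_tendsto_of_tendsto_of_le_of_le' tendsto_const_nhds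
        (tendsto_ofReal_mul_threshold_rpow μ x₀ hs (3 * C / Real.log 2))
        (Eventually.of_forall fun _ => zero_le) ?_
      filter_upwards [eventually_ge_atTop 2] with i hi
      have hi : (2 : ℝ) ≤ i := by exact_mod_cast hi
      have hi1 : (0 : ℝ) < i - 1 := by linarith
      have hε := threshold_pos μ x₀ i
      rw [← ENNReal.ofReal_inv_of_pos (by positivity), ← ENNReal.ofReal_mul (by positivity)]
      refine ENNReal.ofReal_le_ofReal ?_
      have h3i : ((i : ℝ) + 1) / (i - 1) ≤ 3 := by
        rw [div_le_iff₀ hi1]; linarith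
      calc _ = ((i : ℝ) + 1) / (i - 1) *
            (C / Real.log 2 * threshold μ x₀ i ^ (1 / ((n : ℝ) - 1))) := by
              field_simp
        _ ≤ 3 * (C / Real.log 2 * threshold μ x₀ i ^ (1 / ((n : ℝ) - 1))) :=
            mul_le_mul_of_nonneg_right h3i (by positivity)
        _ = _ := by ring
    refine tendsto_zero_of_annulus hb ?_
    filter_upwards [eventually_mem_and_norm_le (E := E) hΩ one_pos] with x hx
    obtain ⟨i, hi, hle⟩ := hsmall x hx.1 hx.2.1 hx.2.2.1 hx.2.2.2
    -- For `i ≤ 1` the bound is infinite, because `ENNReal.ofReal` truncates `(i - 1) log 2` to `0`.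
    refine ⟨i, hi, mul_le_mul' ?_ (hle.trans (le_of_eq ?_))⟩
    · refine ENNReal.inv_le_inv.2 (ENNReal.ofReal_le_ofReal ?_)
      have hd0 : 0 < ‖x - x₀‖ := norm_pos_iff.2 (sub_ne_zero.2 hx.2.2.1)
      have hlog := Real.log_le_log hd0 hi.2
      rw [Real.log_zpow] at hlog
      push_cast at hlog
      rw [one_div, Real.log_inv]
      linarith
    · rw [hα]
      simp

end NonlinearPotential
end

/-- A finite Radon measure on the open set `Ω` is given as a finite Borel measure on `ℝⁿ`
that vanishes outside `Ω`. -/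
theorem theorem5p3 (n : ℕ) (Ω : Set (EuclideanSpace ℝ (Fin n))) (hΩ : IsOpen Ω)
    (μ : Measure (EuclideanSpace ℝ (Fin n))) [IsFiniteMeasure μ] (hμ : μ Ωᶜ = 0)
    (x₀ : EuclideanSpace ℝ (Fin n)) (r₀ : ℝ) (hr₀ : 0 < r₀)
    (hball : Metric.ball x₀ (3 * r₀) ⊆ Ω) :
    (∀ p : ℝ, 1 < p → p < n →
      ∃ E : Set (EuclideanSpace ℝ (Fin n)), E ⊆ Ω ∧ NonlinearPotential.IsPThin p E x₀ ∧
        Tendsto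
          (fun x => ENNReal.ofReal (‖x - x₀‖ ^ (((n : ℝ) - p) / (p - 1))) *
            NonlinearPotential.wolff p μ x r₀)
          (𝓝[{x | x ≠ x₀ ∧ x ∉ E}] x₀)
          (𝓝 (ENNReal.ofReal ((p - 1) / ((n : ℝ) - p)) * μ {x₀} ^ (1 / (p - 1))))) ∧
    (2 ≤ n →
      ∃ E : Set (EuclideanSpace ℝ (Fin n)), E ⊆ Ω ∧ NonlinearPotential.IsNThin E x₀ ∧
        Tendsto
          (fun x => NonlinearPotential.wolff (n : ℝ) μ x r₀ /
            ENNReal.ofReal (Real.log (1 / ‖x - x₀‖)))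
          (𝓝[{x | x ≠ x₀ ∧ x ∉ E}] x₀)
          (𝓝 (μ {x₀} ^ (1 / ((n : ℝ) - 1))))) := by
  have hx : Ω ∈ 𝓝 x₀ := Filter.mem_of_superset (Metric.ball_mem_nhds x₀ (by positivity)) hball
  exact ⟨fun p hp hpn => NonlinearPotential.exists_isPThin_tendsto hp hpn μ hx hr₀,
    fun hn => NonlinearPotential.exists_isNThin_tendsto hn μ hx hr₀⟩
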